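/- Let $p \ge 5$ be a prime and let $\ell$ be a prime that is a topological generator of $\mathbb{Z}_p^\times$. For $N \in \{1, \ell\}$ let $M_k(\Gamma_0(N))$ be the group of weight $k$ modular forms for $\Gamma_0(N)$ whose $q$-expansion at $\infty$ has coefficients in $\mathbb{Z}$, let $M_k(\Gamma_0(N))^0$ be the weight $k$ part of $M_*(\Gamma_0(N))[\Delta^{-1}]$, and put $M_k(\Gamma_0(N))^0_{\mathbb{Z}_p} = M_k(\Gamma_0(N))^0 \otimes \mathbb{Z}_p$; write $M_k = M_k(\Gamma_0(1))$. Let $C(\ell)_{2k}^\bullet$ be the semi-cosimplicial abelian group of modular forms which begins with $$ C(\ell)_{2k}^0 = (M_k)^0_{\mathbb{Z}_p} \rightrightarrows C(\ell)_{2k}^1 = M_k(\Gamma_0(\ell))^0_{\mathbb{Z}_p} \times (M_k)^0_{\mathbb{Z}_p}, $$ where $d_0$ is induced by $(C,H) \mapsto C/H$ and $C \mapsto C/C[\ell]$, and $d_1$ by $(C,H) \mapsto C$ and $C \mapsto C$; on $q$-expansions $d_0 f = (\ell^k f(q^\ell), \ell^k f(q))$ and $d_1 f = (f(q), f(q))$.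 For $t \ge 0$ let $$ \mathcal{A}_{t/j} = H^0(C(\ell)^\bullet/p^j)_{2t} = \ker\bigl(d_0 - d_1 : C(\ell)^0_{2t}/p^j \to C(\ell)^1_{2t}/p^j\bigr), \qquad \mathcal{A}_{t/\infty} = \operatorname{colim}_j \mathcal{A}_{t/j}, $$ the transition maps $\mathcal{A}_{t/i} \to \mathcal{A}_{t/j}$ $(i \le j)$ being induced by multiplication by $p^{j-i}$. Let $E_t = 1 - \frac{2t}{B_t}\sum_{n \ge 1} \sigma_{t-1}(n) q^n$ be the normalized Eisenstein series. 1. Let $t = (p-1)p^{j-1}s$ with $j \ge 1$, $(s,p) = 1$ and $t \ge 4$. Then $E_t$ is $p$-integral, i.e. it defines a (unique) element of $(M_t)^0_{\mathbb{Z}_p}$; its class modulo $p^j$ lies in $\mathcal{A}_{t/j}$; and $\mathcal{A}_{t/\infty}$ is cyclic of order $p^j$, generated by the image $E_t/p^j$ of $E_t \in \mathcal{A}_{t/j}$. Moreover $p^j$ is the exact power of $p$ dividing the denominator of $B_t/t$. 2. $\mathcal{A}_{0/\infty} \cong \mathbb{Z}/p^\infty$ $(= \mathbb{Q}_p/\mathbb{Z}_p)$.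 -/

import Mathlib

open UpperHalfPlane ModularForm MatrixGroups Matrix.SpecialLinearGroup Filter
open scoped Manifold TensorProduct

noncomputable section
namespace QlComplex

/-- `Γ₀(N)`, as a subgroup of `GL₂(ℝ)`. -/
abbrev G0 (N : ℕ) : Subgroup (GL (Fin 2) ℝ) := (CongruenceSubgroup.Gamma0 N).map (mapGL ℝ)

lemma one_mem_strictPeriods (N : ℕ) : (1 : ℝ) ∈ (G0 N).strictPeriods := by
  simp [G0, AddSubgroup.mem_zmultiples]

lemma discriminant_slash (γ : SL(2, ℤ)) :
    (discriminant : ℍ → ℂ) ∣[(12 : ℤ)] (γ : GL (Fin 2) ℝ) = discriminant :=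
  CuspForm.discriminant.slash_action_eq' _ ⟨γ, rfl⟩

lemma isCusp_SL2Z {N : ℕ} {c : OnePoint ℝ} (hc : IsCusp c (G0 N)) : IsCusp c 𝒮ℒ := by
  refine hc.mono ?_
  rintro _ ⟨γ, -, rfl⟩
  exact ⟨γ, rfl⟩

/-- A form of level one, viewed as a form for `Γ₀(N)`. -/
def restrict (N : ℕ) {k : ℤ} (f : ℍ → ℂ) (hinv : ∀ γ : SL(2, ℤ), f ∣[k] (γ : GL (Fin 2) ℝ) = f)
    (hol : MDiff f) (hbd : IsBoundedAtImInfty f) : ModularForm (G0 N) k where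
  toFun := f
  slash_action_eq' := by
    rintro _ ⟨γ, -, rfl⟩
    exact hinv γ
  holo' := hol
  bdd_at_cusps' {c} hc := by
    rw [OnePoint.isBoundedAt_iff_forall_SL2Z (isCusp_SL2Z hc)]
    intro γ _
    rw [SL_slash, hinv γ]
    exact hbd

/-- The discriminant as a modular form of weight `12` for `Γ₀(N)`. -/
def deltaForm (N : ℕ) : ModularForm (G0 N) 12 :=
  restrict N discriminant discriminant_slash CuspForm.discriminant.holo'
    discriminant_isZeroAtImInfty.isBoundedAtImInfty

/-- The matrix `diag(l, 1)`, which acts on the upper half plane by `τ ↦ l τ`. -/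
def scal (l : ℕ) [NeZero l] : GL (Fin 2) ℝ :=
  Matrix.GeneralLinearGroup.mkOfDetNeZero !![(l : ℝ), 0; 0, 1] (by simp [NeZero.ne l])

lemma exists_triangular (l : ℕ) [NeZero l] (γ : SL(2, ℤ)) :
    ∃ (γ' : SL(2, ℤ)) (β : GL (Fin 2) ℝ), scal l * (γ : GL (Fin 2) ℝ) = (γ' : GL (Fin 2) ℝ) * β ∧
      β 1 0 = 0 ∧ β.det.val = l ∧ 1 ≤ (β 1 1) ^ 2 := by
  obtain ⟨γ', hγ'⟩ : ∃ γ' : SL(2, ℤ), γ' 0 0 * γ 1 0 = γ' 1 0 * (l * γ 0 0) := by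
    have hne : (l * γ 0 0 : ℤ) ≠ 0 ∨ γ 1 0 ≠ 0 := by
      by_contra! h
      have h0 : γ 0 0 = 0 := by simpa [NeZero.ne l] using h.1
      have := γ.det_coe
      rw [Matrix.det_fin_two, h.2, h0] at this
      simp at this
    have hg : 0 < Int.gcd (l * γ 0 0 : ℤ) (γ 1 0) := by
      rw [Nat.pos_iff_ne_zero]
      intro h
      rw [Int.gcd_eq_zero_iff] at h
      tauto
    obtain ⟨u, v, h1, h2, h3⟩ := Int.exists_gcd_one hg
    obtain ⟨g, hg0, hg1⟩ := (Int.isCoprime_iff_gcd_eq_one.mpr h1).exists_SL2_col 0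
    refine ⟨g, ?_⟩
    rw [hg0, hg1, h2]
    nth_rewrite 1 [h3]
    ring
  let B : Matrix (Fin 2) (Fin 2) ℤ :=
    (γ'⁻¹ : SL(2, ℤ)).1 * !![(l : ℤ), 0; 0, 1] * γ.1
  let β : GL (Fin 2) ℝ := (γ' : GL (Fin 2) ℝ)⁻¹ * (scal l * (γ : GL (Fin 2) ℝ))
  have hβ : ∀ i j, β i j = (B i j : ℝ) := by
    intro i j
    have : β.1 = B.map (Int.castRingHom ℝ) := by
      simp only [β, B, Matrix.map_mul, ← mul_assoc, Units.val_mul, ← map_inv]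
      congr 2
      ext i j
      fin_cases i <;> fin_cases j <;> simp [scal]
    rw [this]
    simp
  have hdet : β.det.val = l := by
    simp [β, scal]
  have h10 : β 1 0 = 0 := by
    have e0 : (γ'⁻¹ : SL(2, ℤ)).1 1 0 = -γ' 1 0 := by
      rw [Matrix.SpecialLinearGroup.SL2_inv_expl]; rfl
    have e1 : (γ'⁻¹ : SL(2, ℤ)).1 1 1 = γ' 0 0 := by
      rw [Matrix.SpecialLinearGroup.SL2_inv_expl]; rfl
    rw [hβ]
    simp only [B, Matrix.mul_apply, Fin.sum_univ_two, e0, e1]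
    have : -γ' 1 0 * (l * γ 0 0) + γ' 0 0 * γ 1 0 = 0 := by rw [hγ']; ring
    simp
    push_cast [← Int.cast_inj (α := ℝ)] at this
    linarith
  refine ⟨γ', β, by simp [β], h10, hdet, ?_⟩
  have h := hdet
  rw [Matrix.GeneralLinearGroup.val_det_apply, Matrix.det_fin_two, h10, mul_zero, sub_zero] at h
  have hB : B 1 1 ≠ 0 := by
    intro h0
    rw [hβ 1 1, h0, Int.cast_zero, mul_zero] at h
    exact NeZero.ne l (by exact_mod_cast h.symm)
  rw [hβ]
  exact_mod_cast Int.one_le_abs hB |> (one_le_sq_iff_one_le_abs _).mpr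
  
lemma discriminant_bound (l : ℕ) [NeZero l] (β : GL (Fin 2) ℝ) (h10 : β 1 0 = 0)
    (hdet : β.det.val = l) (h11 : 1 ≤ (β 1 1) ^ 2) :
    (fun τ : ℍ => discriminant τ ^ l) =O[atImInfty] fun τ => discriminant (β • τ) := by
  have h1 : (discriminant : ℍ → ℂ) =O[atImInfty] fun τ => Real.exp (-2 * Real.pi * τ.im) := by
    simpa using CuspFormClass.exp_decay_atImInfty (h := 1) CuspForm.discriminant one_pos
      one_mem_strictPeriods_SL
  have h2 := exp_isBigO_discriminant.comp_tendsto (tendsto_smul_atImInfty h10)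
  refine (h1.pow l).trans (Asymptotics.IsBigO.trans ?_ h2)
  refine Asymptotics.IsBigO.of_bound 1 (Eventually.of_forall fun τ => ?_)
  have him : (β • τ).im ≤ l * τ.im := by
    rw [im_smul_eq_div_normSq, hdet]
    have : Complex.normSq (denom β τ) = (β 1 1) ^ 2 := by
      simp [denom, h10, Complex.normSq_apply, sq]
    rw [this, Nat.abs_cast]
    exact div_le_self (by have := τ.im_pos; positivity) h11
  simp only [Function.comp, ← Real.exp_nat_mul, Real.norm_eq_abs, Real.abs_exp, one_mul,
    Real.exp_le_exp]
  have := Real.pi_pos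
  nlinarith

lemma isBounded_slash_mul (l n : ℕ) [NeZero l] (k : ℤ) (f : ℍ → ℂ)
    (hbd : IsBoundedAtImInfty fun τ => f τ * discriminant τ ^ n)
    (β : GL (Fin 2) ℝ) (h10 : β 1 0 = 0) (hdet : β.det.val = l) (h11 : 1 ≤ (β 1 1) ^ 2) :
    IsBoundedAtImInfty ((f ∣[k] β) * (discriminant : ℍ → ℂ) ^ (l * n)) := by
  have h1 := ((discriminant_bound l β h10 hdet h11).pow n).mul
    (Asymptotics.isBigO_refl (f ∣[k] β) atImInfty)
  have h2 := Asymptotics.IsBigO.comp_tendsto hbd (tendsto_smul_atImInfty h10)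
  have h3 : (fun τ => discriminant (β • τ) ^ n * (f ∣[k] β) τ) =O[atImInfty]
      ((fun τ => f τ * discriminant τ ^ n) ∘ fun τ => β • τ) := by
    refine Asymptotics.IsBigO.of_bound (‖((|β.det.val| : ℝ) : ℂ) ^ (k - 1) * ((β 1 1 : ℝ) : ℂ) ^ (-k)‖)
      (Eventually.of_forall fun τ => le_of_eq ?_)
    have hd : denom β τ = ((β 1 1 : ℝ) : ℂ) := by simp [denom, h10]
    have hs : σ β (f (β • τ)) = f (β • τ) := by
      simp [σ, hdet, NeZero.pos l]
    rw [ModularForm.slash_apply, hd, hs]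
    simp only [Function.comp, norm_mul]
    ring
  refine ((h1.trans h3).trans h2).congr_left fun τ => ?_
  simp [pow_mul, mul_comm]

lemma scal_smul (l : ℕ) [NeZero l] (τ : ℍ) : ((scal l • τ : ℍ) : ℂ) = l * τ := by
  rw [coe_smul_of_det_pos (by simp [scal, NeZero.pos l])]
  simp [num, denom, scal]

lemma scal_slash (l : ℕ) [NeZero l] (k : ℤ) (f : ℍ → ℂ) (τ : ℍ) :
    (f ∣[k] scal l) τ = (l : ℂ) ^ (k - 1) * f (scal l • τ) := by
  rw [ModularForm.slash_apply]
  simp [σ, denom, scal, NeZero.pos l, mul_comm]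

lemma scal_conj (l : ℕ) [NeZero l] (γ : SL(2, ℤ)) (hγ : γ ∈ CongruenceSubgroup.Gamma0 l) :
    ∃ γ' : SL(2, ℤ), scal l * (γ : GL (Fin 2) ℝ) = (γ' : GL (Fin 2) ℝ) * scal l := by
  rw [CongruenceSubgroup.Gamma0_mem, ZMod.intCast_zmod_eq_zero_iff_dvd] at hγ
  obtain ⟨c, hc⟩ := hγ
  have hdet := γ.det_coe
  rw [Matrix.det_fin_two, hc] at hdet
  refine ⟨⟨!![γ 0 0, l * γ 0 1; c, γ 1 1], by rw [Matrix.det_fin_two_of]; linarith⟩, ?_⟩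
  ext i j
  fin_cases i <;> fin_cases j <;> simp [scal, Matrix.mul_apply, hc, mul_comm]
  · exact Or.inl rfl
  · exact (Int.cast_mul _ _).symm.trans rfl
  · exact (mul_comm _ _).trans rfl
  · rfl

lemma discriminant_pow_slash (n : ℕ) (γ : SL(2, ℤ)) :
    ((discriminant : ℍ → ℂ) ^ n) ∣[(12 * n : ℤ)] (γ : GL (Fin 2) ℝ) =
      (discriminant : ℍ → ℂ) ^ n := by
  induction n with
  | zero => simp
  | succ m ih =>
    have h : (12 * ((m + 1 : ℕ) : ℤ)) = 12 * (m : ℤ) + 12 := by push_cast; ring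
    rw [pow_succ, h, ModularForm.mul_slash, ih, discriminant_slash]
    simp

/-- If `f` has weight `k` and level one and `f Δ ^ n` is bounded at the cusp, then
`f(l τ) Δ(τ) ^ (l n)` is a modular form for `Γ₀(l)`. -/
lemma exists_levelRaise (l n : ℕ) [NeZero l] (k : ℤ) (f : ℍ → ℂ)
    (hinv : ∀ γ : SL(2, ℤ), f ∣[k] (γ : GL (Fin 2) ℝ) = f)
    (hol : MDiff f) (hbd : IsBoundedAtImInfty fun τ => f τ * discriminant τ ^ n) :
    ∃ G : ModularForm (G0 l) (k + 12 * (l * n : ℕ)),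
      ∀ τ : ℍ, G τ = f (scal l • τ) * discriminant τ ^ (l * n) := by
  have key : ∀ γ : SL(2, ℤ), ((f ∣[k] scal l) * (discriminant : ℍ → ℂ) ^ (l * n))
      ∣[k + 12 * (l * n : ℕ)] (γ : GL (Fin 2) ℝ) =
      (f ∣[k] (scal l * (γ : GL (Fin 2) ℝ))) * (discriminant : ℍ → ℂ) ^ (l * n) := by
    intro γ
    rw [ModularForm.mul_slash, discriminant_pow_slash, SlashAction.slash_mul]
    simp
  let G : ModularForm (G0 l) (k + 12 * (l * n : ℕ)) :=
    { toFun := (f ∣[k] scal l) * (discriminant : ℍ → ℂ) ^ (l * n)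
      slash_action_eq' := by
        rintro _ ⟨γ, hγ, rfl⟩
        obtain ⟨γ', h⟩ := scal_conj l γ hγ
        refine (key γ).trans ?_
        rw [h, SlashAction.slash_mul, hinv]
      holo' := (hol.slash k _).mul (CuspForm.discriminant.holo'.pow _)
      bdd_at_cusps' := by
        intro c hc
        rw [OnePoint.isBoundedAt_iff_forall_SL2Z (isCusp_SL2Z hc)]
        intro γ _
        rw [SL_slash]
        obtain ⟨γ', β, h, h10, hdet, h11⟩ := exists_triangular l γ
        rw [show (_ ∣[k + 12 * (l * n : ℕ)] (γ : GL (Fin 2) ℝ)) = _ from key γ, h,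
          SlashAction.slash_mul, hinv]
        exact isBounded_slash_mul l n k f hbd β h10 hdet h11 }
  refine ⟨((l : ℂ) ^ (1 - k)) • G, fun τ => ?_⟩
  have hG : G τ = (f ∣[k] scal l) τ * discriminant τ ^ (l * n) := rfl
  have hl : (l : ℂ) ≠ 0 := NeZero.ne _
  rw [FunLike.coe_smul, Pi.smul_apply, hG, scal_slash, smul_eq_mul, ← mul_assoc, ← mul_assoc,
    ← zpow_add₀ hl]
  simp

/-- The power series with integer coefficients, as a subring of `ℂ⟦q⟧`. -/
abbrev intSeries : Subring (PowerSeries ℂ) := (PowerSeries.map (Int.castRingHom ℂ)).range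

lemma mem_intSeries {P : PowerSeries ℂ} : P ∈ intSeries ↔ ∀ m, ∃ a : ℤ, P.coeff m = a := by
  constructor
  · rintro ⟨Q, rfl⟩ m
    exact ⟨Q.coeff m, by simp⟩
  · intro h
    choose a ha using h
    exact ⟨PowerSeries.mk a, by ext m; simp [ha]⟩

lemma mem_intSeries_of_mul {A P : PowerSeries ℂ} (hA : A ∈ intSeries)
    (h1 : PowerSeries.constantCoeff A = 1) (h : A * P ∈ intSeries) : P ∈ intSeries := by
  obtain ⟨a, rfl⟩ := hA
  have hu : IsUnit a := by
    rw [PowerSeries.isUnit_iff_constantCoeff]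
    have : ((PowerSeries.constantCoeff a : ℤ) : ℂ) = 1 := by
      rw [← PowerSeries.coeff_zero_eq_constantCoeff_apply] at h1 ⊢
      rwa [PowerSeries.coeff_map] at h1
    rw [show PowerSeries.constantCoeff a = 1 by exact_mod_cast this]
    exact isUnit_one
  obtain ⟨b, hb⟩ := hu.exists_left_inv
  have : P = PowerSeries.map (Int.castRingHom ℂ) b * (PowerSeries.map (Int.castRingHom ℂ) a * P) := by
    rw [← mul_assoc, ← map_mul, hb, map_one, one_mul]
  rw [this]
  exact mul_mem ⟨b, rfl⟩ h

/-- The series `∑ σ_k(m) q ^ m`. -/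
def sigmaSeries (k : ℕ) : PowerSeries ℂ := PowerSeries.mk fun m => (ArithmeticFunction.sigma k m : ℂ)

lemma sigmaSeries_mem (k : ℕ) : sigmaSeries k ∈ intSeries :=
  mem_intSeries.mpr fun m => ⟨ArithmeticFunction.sigma k m, by simp [sigmaSeries]⟩

lemma E_qExpansion_eq {k : ℕ} (hk : 3 ≤ k) (hk2 : Even k) :
    qExpansion 1 (E hk) =
      1 + PowerSeries.C (-(2 * k / bernoulli k : ℂ)) * sigmaSeries (k - 1) := by
  ext m
  rw [EisensteinSeries.E_qExpansion_coeff hk hk2, map_add, PowerSeries.coeff_C_mul,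
    PowerSeries.coeff_one]
  by_cases hm : m = 0 <;> simp [hm, sigmaSeries]

lemma twelve_dvd (m : ℕ) : ∃ w : ℤ,
    5 * (ArithmeticFunction.sigma 3 m : ℤ) + 7 * (ArithmeticFunction.sigma 5 m : ℤ) = 12 * w := by
  change (12 : ℤ) ∣ _
  simp only [ArithmeticFunction.sigma_apply]
  push_cast
  rw [Finset.mul_sum, Finset.mul_sum, ← Finset.sum_add_distrib]
  refine Finset.dvd_sum fun d _ => ?_
  have : ∀ x : ZMod 12, 5 * x ^ 3 + 7 * x ^ 5 = 0 := by decide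
  refine (ZMod.intCast_zmod_eq_zero_iff_dvd _ 12).mp ?_
  push_cast
  exact this d

lemma discriminant_mem_intSeries : qExpansion 1 (discriminant : ℍ → ℂ) ∈ intSeries := by
  have h4 : qExpansion 1 E₄ = 1 + 240 * sigmaSeries 3 := by
    rw [E_qExpansion_eq _ ⟨2, rfl⟩, show bernoulli 4 = -1 / 30 by decide +kernel,
      ← map_ofNat (PowerSeries.C (R := ℂ)) 240]
    norm_num
  have h6 : qExpansion 1 E₆ = 1 - 504 * sigmaSeries 5 := by
    rw [E_qExpansion_eq _ ⟨3, rfl⟩, show bernoulli 6 = 1 / 42 by decide +kernel,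
      ← map_ofNat (PowerSeries.C (R := ℂ)) 504, sub_eq_add_neg, ← neg_mul, ← map_neg]
    norm_num
  have hper : (1 : ℝ) ∈ (𝒮ℒ : Subgroup (GL (Fin 2) ℝ)).strictPeriods := one_mem_strictPeriods_SL
  have hΔ : 1728 * qExpansion 1 (discriminant : ℍ → ℂ) =
      qExpansion 1 E₄ ^ 3 - qExpansion 1 E₆ ^ 2 := by
    have hf : (1728 : ℂ) • (discriminant : ℍ → ℂ) =
        ⇑(E₄.pow 3) - ⇑(E₆.pow 2) := by
      ext τ
      simp only [Pi.smul_apply, Pi.sub_apply, ModularForm.coe_pow, Pi.pow_apply, smul_eq_mul,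
        discriminant_eq_E₄_cube_sub_E₆_sq]
      ring
    have h := congrArg (qExpansion 1) hf
    rw [ModularForm.qExpansion_sub one_pos hper, ModularForm.qExpansion_pow one_pos hper,
      ModularForm.qExpansion_pow one_pos hper] at h
    rw [← h, ← CuspForm.coe_discriminant, ModularForm.qExpansion_smul one_pos hper,
      ← map_ofNat (PowerSeries.C (R := ℂ)) 1728, PowerSeries.smul_eq_C_mul]
  choose w hw using twelve_dvd
  have hW : 5 * sigmaSeries 3 + 7 * sigmaSeries 5 =
      12 * PowerSeries.map (Int.castRingHom ℂ) (PowerSeries.mk w) := by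
    ext m
    rw [← map_ofNat (PowerSeries.C (R := ℂ)) 5, ← map_ofNat (PowerSeries.C (R := ℂ)) 7,
      ← map_ofNat (PowerSeries.C (R := ℂ)) 12, map_add, PowerSeries.coeff_C_mul,
      PowerSeries.coeff_C_mul, PowerSeries.coeff_C_mul, PowerSeries.coeff_map]
    simp only [sigmaSeries, PowerSeries.coeff_mk]
    have h : ((5 * (ArithmeticFunction.sigma 3 m : ℤ) + 7 * (ArithmeticFunction.sigma 5 m : ℤ) : ℤ) : ℂ)
        = ((12 * w m : ℤ) : ℂ) := congrArg _ (hw m)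
    push_cast at h
    exact h
  have h1728 : (1728 : PowerSeries ℂ) ≠ 0 := by
    rw [← map_ofNat (PowerSeries.C (R := ℂ)) 1728]
    simp
  have hmem := sigmaSeries_mem
  have : qExpansion 1 (discriminant : ℍ → ℂ) =
      PowerSeries.map (Int.castRingHom ℂ) (PowerSeries.mk w) + 100 * sigmaSeries 3 ^ 2 +
        8000 * sigmaSeries 3 ^ 3 - 147 * sigmaSeries 5 ^ 2 := by
    apply mul_left_cancel₀ h1728
    rw [hΔ, h4, h6]
    linear_combination 144 * hW
  rw [this]
  refine sub_mem (add_mem (add_mem ⟨_, rfl⟩ ?_) ?_) ?_ <;>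
  exact mul_mem (ofNat_mem _ _) (pow_mem (hmem _) _)

lemma discriminant_qExpansion : ∃ U ∈ intSeries, PowerSeries.constantCoeff U = 1 ∧
    qExpansion 1 (discriminant : ℍ → ℂ) = PowerSeries.X * U := by
  have h0 : (qExpansion 1 (discriminant : ℍ → ℂ)).coeff 0 = 0 :=
    CuspFormClass.qExpansion_coeff_zero CuspForm.discriminant one_pos one_mem_strictPeriods_SL
  obtain ⟨U, hU⟩ := PowerSeries.X_dvd_iff.mpr
    ((PowerSeries.coeff_zero_eq_constantCoeff_apply _).symm.trans h0)
  refine ⟨U, ?_, ?_, hU⟩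
  · rw [mem_intSeries]
    intro m
    have := mem_intSeries.mp discriminant_mem_intSeries (m + 1)
    rwa [hU, PowerSeries.coeff_succ_X_mul] at this
  · have := discriminant_qExpansion_coeff_one
    rw [hU, PowerSeries.coeff_succ_X_mul] at this
    exact (PowerSeries.coeff_zero_eq_constantCoeff_apply _).symm.trans this

/-- `M_k(Γ₀(N))`: the modular forms of weight `k` for `Γ₀(N)` whose `q`-expansion at the cusp `∞`
has integer coefficients. -/
def integralForms (N : ℕ) (k : ℤ) : AddSubgroup (ModularForm (G0 N) k) where
  carrier := {g | ∀ m : ℕ, ∃ a : ℤ, (qExpansion 1 g).coeff m = a}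
  zero_mem' m := ⟨0, by simp [FunLike.coe_zero, UpperHalfPlane.qExpansion_zero]⟩
  add_mem' {f g} hf hg m := by
    obtain ⟨a, ha⟩ := hf m
    obtain ⟨b, hb⟩ := hg m
    refine ⟨a + b, ?_⟩
    rw [FunLike.coe_add, ModularForm.qExpansion_add one_pos (one_mem_strictPeriods N), map_add,
      ha, hb, Int.cast_add]
  neg_mem' {f} hf m := by
    obtain ⟨a, ha⟩ := hf m
    refine ⟨-a, ?_⟩
    rw [FunLike.coe_neg, ModularForm.qExpansion_neg one_pos (one_mem_strictPeriods N), map_neg,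
      ha, Int.cast_neg]

lemma mem_integralForms {N : ℕ} {k : ℤ} {g : ModularForm (G0 N) k} :
    g ∈ integralForms N k ↔ qExpansion 1 g ∈ intSeries := mem_intSeries.symm

lemma exists_mul_discriminant {N : ℕ} {k : ℤ} {g : ModularForm (G0 N) k}
    (hg : g ∈ integralForms N k) (n : ℕ) {k' : ℤ} (hk' : k' = k + 12 * n) :
    ∃ g' ∈ integralForms N k', ∀ τ, g' τ = g τ * discriminant τ ^ n := by
  subst hk'
  refine ⟨ModularForm.mcast (by ring) (g.mul ((deltaForm N).pow n)), ?_, ?_⟩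
  · rw [mem_integralForms] at hg ⊢
    rw [ModularForm.qExpansion_mcast, ModularForm.qExpansion_mul one_pos (one_mem_strictPeriods N),
      ModularForm.qExpansion_pow one_pos (one_mem_strictPeriods N)]
    exact mul_mem hg (pow_mem discriminant_mem_intSeries n)
  · intro τ
    rw [ModularForm.coe_mcast, ModularForm.coe_mul, Pi.mul_apply, ModularForm.coe_pow]
    rfl

/-- `M_k(Γ₀(N))⁰`: the weight `k` part of `M_*(Γ₀(N))[Δ⁻¹]`, that is, the functions `g / Δ ^ n` with
`g` in `M_{k + 12 n}(Γ₀(N))`. -/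
def weakForms (N : ℕ) (k : ℤ) : AddSubgroup (ℍ → ℂ) where
  carrier := {f | ∃ n : ℕ, ∃ g ∈ integralForms N (k + 12 * n),
    ∀ τ, f τ * discriminant τ ^ n = g τ}
  zero_mem' := ⟨0, 0, zero_mem _, by simp⟩
  add_mem' := by
    rintro f₁ f₂ ⟨n₁, g₁, hg₁, h₁⟩ ⟨n₂, g₂, hg₂, h₂⟩
    obtain ⟨e₁, he₁, h₁'⟩ := exists_mul_discriminant hg₁ n₂ (k' := k + 12 * (n₁ + n₂ : ℕ))
      (by push_cast; ring)
    obtain ⟨e₂, he₂, h₂'⟩ := exists_mul_discriminant hg₂ n₁ (k' := k + 12 * (n₁ + n₂ : ℕ))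
      (by push_cast; ring)
    refine ⟨n₁ + n₂, e₁ + e₂, add_mem he₁ he₂, fun τ => ?_⟩
    rw [FunLike.coe_add, Pi.add_apply, Pi.add_apply, h₁', h₂', ← h₁, ← h₂]
    ring
  neg_mem' := by
    rintro f ⟨n, g, hg, h⟩
    refine ⟨n, -g, neg_mem hg, fun τ => ?_⟩
    rw [FunLike.coe_neg, Pi.neg_apply, Pi.neg_apply, ← h]
    ring

lemma slash_of_mul {N : ℕ} {k : ℤ} {n : ℕ} {f : ℍ → ℂ} {g : ModularForm (G0 N) (k + 12 * n)}
    (h : ∀ τ, f τ * discriminant τ ^ n = g τ) (γ : SL(2, ℤ)) (hγ : γ ∈ CongruenceSubgroup.Gamma0 N) :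
    f ∣[k] (γ : GL (Fin 2) ℝ) = f := by
  have hfg : f * (discriminant : ℍ → ℂ) ^ n = g := funext h
  have h1 : (g : ℍ → ℂ) ∣[k + 12 * (n : ℤ)] (γ : GL (Fin 2) ℝ) = g :=
    g.slash_action_eq' _ ⟨γ, hγ, rfl⟩
  rw [← hfg, ModularForm.mul_slash, discriminant_pow_slash] at h1
  ext τ
  have h2 := congrFun h1 τ
  have hdet : (Matrix.GeneralLinearGroup.det (γ : GL (Fin 2) ℝ)).val = 1 := by simp
  rw [hdet, abs_one, one_smul, Pi.mul_apply, Pi.mul_apply, Pi.pow_apply] at h2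
  exact mul_right_cancel₀ (pow_ne_zero n (discriminant_ne_zero τ)) h2

lemma mdiff_of_mul {N : ℕ} {k : ℤ} {n : ℕ} {f : ℍ → ℂ} {g : ModularForm (G0 N) (k + 12 * n)}
    (h : ∀ τ, f τ * discriminant τ ^ n = g τ) : MDiff f := by
  have hg := UpperHalfPlane.mdifferentiable_iff.mp g.holo'
  have hΔ := UpperHalfPlane.mdifferentiable_iff.mp CuspForm.discriminant.holo'
  rw [UpperHalfPlane.mdifferentiable_iff]
  refine (hg.div (hΔ.pow n) fun z _ => pow_ne_zero n (discriminant_ne_zero _)).congr fun z _ => ?_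
  exact eq_div_of_mul_eq (pow_ne_zero n (discriminant_ne_zero _)) (h _)

lemma mem_Gamma0_one (γ : SL(2, ℤ)) : γ ∈ CongruenceSubgroup.Gamma0 1 := by
  rw [CongruenceSubgroup.Gamma0_mem]; exact Subsingleton.elim _ _

lemma levelRaise_qExpansion {l : ℕ} [NeZero l] {k k' : ℤ} {g : ModularForm (G0 1) k}
    {G : ModularForm (G0 l) k'} (h : ∀ τ, G τ = g (scal l • τ)) (m : ℕ) :
    (qExpansion 1 G).coeff m = if l ∣ m then (qExpansion 1 g).coeff (m / l) else 0 := by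
  refine (ModularFormClass.qExpansion_coeff_unique one_pos (one_mem_strictPeriods l) (f := G)
    (c := fun m => if l ∣ m then (qExpansion 1 g).coeff (m / l) else 0) (fun τ => ?_) m).symm
  have hl : 0 < l := NeZero.pos l
  have h1 := ModularForm.hasSum_qExpansion (f := g) one_pos (one_mem_strictPeriods 1) (scal l • τ)
  have hinj : Function.Injective fun m : ℕ => l * m := fun a b hab => Nat.eq_of_mul_eq_mul_left hl hab
  rw [h, ← hinj.hasSum_iff]
  · convert h1 using 2 with m
    simp only [Function.comp, dvd_mul_right, if_true, Nat.mul_div_cancel_left _ hl, smul_eq_mul,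
      pow_mul]
    congr 2
    rw [Function.Periodic.qParam, Function.Periodic.qParam, scal_smul, ← Complex.exp_nat_mul]
    congr 1
    push_cast
    ring
  · intro x hx
    have : ¬ l ∣ x := fun ⟨y, hy⟩ => hx ⟨y, hy.symm⟩
    simp [this]

lemma comp_scal_mem (l : ℕ) [NeZero l] (k : ℤ) {f : ℍ → ℂ} (hf : f ∈ weakForms 1 k) :
    (fun τ => f (scal l • τ)) ∈ weakForms l k := by
  obtain ⟨n, g, hg, h⟩ := hf
  have hbdf : IsBoundedAtImInfty fun τ => f τ * discriminant τ ^ n := by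
    rw [show (fun τ => f τ * discriminant τ ^ n) = g from funext h]
    exact ModularFormClass.bdd_at_infty g
  obtain ⟨G, hG⟩ := exists_levelRaise l n k f
    (fun γ => slash_of_mul h γ (mem_Gamma0_one γ)) (mdiff_of_mul h) hbdf
  obtain ⟨P, hP⟩ := exists_levelRaise l 0 (k + 12 * n) g
    (fun γ => g.slash_action_eq' _ ⟨γ, mem_Gamma0_one γ, rfl⟩) g.holo'
    (by simpa using ModularFormClass.bdd_at_infty g)
  obtain ⟨D, hD⟩ := exists_levelRaise l 0 12 discriminant discriminant_slash
    CuspForm.discriminant.holo' (by simpa using discriminant_isZeroAtImInfty.isBoundedAtImInfty)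
  simp only [mul_zero, pow_zero, mul_one] at hP hD
  refine ⟨l * n, G, ?_, fun τ => (hG τ).symm⟩
  have hfun : (G : ℍ → ℂ) * (D.pow n : ℍ → ℂ) = P * ((deltaForm l).pow (l * n) : ℍ → ℂ) := by
    ext τ
    have hδ : deltaForm l τ = discriminant τ := rfl
    simp only [Pi.mul_apply, ModularForm.coe_pow, Pi.pow_apply, hG, hD, hP, hδ, ← h]
    ring
  have hq := congrArg (qExpansion 1) hfun
  rw [ModularForm.qExpansion_mul_coe one_pos (one_mem_strictPeriods l),
    ModularForm.qExpansion_mul_coe one_pos (one_mem_strictPeriods l),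
    ModularForm.qExpansion_pow one_pos (one_mem_strictPeriods l),
    ModularForm.qExpansion_pow one_pos (one_mem_strictPeriods l)] at hq
  obtain ⟨U, hU, hU1, hUΔ⟩ := discriminant_qExpansion
  have hPint : qExpansion 1 P ∈ intSeries := by
    rw [mem_intSeries]
    intro m
    rw [levelRaise_qExpansion hP]
    split_ifs
    · exact hg _
    · exact ⟨0, by simp⟩
  have hDc : ∀ m, (qExpansion 1 D).coeff m =
      if l ∣ m then (qExpansion 1 (discriminant : ℍ → ℂ)).coeff (m / l) else 0 :=
    levelRaise_qExpansion (g := deltaForm 1) hD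
  obtain ⟨W, hW⟩ : PowerSeries.X ^ l ∣ qExpansion 1 D := by
    rw [PowerSeries.X_pow_dvd_iff]
    intro m hm
    rw [hDc]
    split_ifs with hd
    · rw [Nat.eq_zero_of_dvd_of_lt hd hm, hUΔ]
      simp
    · rfl
  have hWc : ∀ m, W.coeff m =
      if l ∣ m + l then (qExpansion 1 (discriminant : ℍ → ℂ)).coeff ((m + l) / l) else 0 := by
    intro m
    rw [← hDc, hW, PowerSeries.coeff_X_pow_mul]
  have hWint : W ∈ intSeries := by
    rw [mem_intSeries]
    intro m
    rw [hWc]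
    split_ifs
    · exact mem_intSeries.mp discriminant_mem_intSeries _
    · exact ⟨0, by simp⟩
  have hW1 : PowerSeries.constantCoeff W = 1 := by
    rw [← PowerSeries.coeff_zero_eq_constantCoeff_apply, hWc]
    simp [NeZero.pos l, discriminant_qExpansion_coeff_one]
  rw [mem_integralForms]
  refine mem_intSeries_of_mul (A := W ^ n) (pow_mem hWint n) (by simp [hW1]) ?_
  have hδ : qExpansion 1 (deltaForm l) = PowerSeries.X * U := hUΔ
  have hX : (PowerSeries.X : PowerSeries ℂ) ^ (l * n) ≠ 0 := pow_ne_zero _ PowerSeries.X_ne_zero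
  have : W ^ n * qExpansion 1 G = qExpansion 1 P * U ^ (l * n) := by
    apply mul_left_cancel₀ hX
    rw [hW, hδ] at hq
    rw [mul_pow, mul_pow, ← pow_mul] at hq
    linear_combination hq
  rw [this]
  exact mul_mem hPint (pow_mem hU _)

lemma weakForms_le (N : ℕ) (k : ℤ) : weakForms 1 k ≤ weakForms N k := by
  rintro f ⟨n, g, hg, h⟩
  refine ⟨n, restrict N g (fun γ => g.slash_action_eq' _ ⟨γ, mem_Gamma0_one γ, rfl⟩) g.holo'
    (ModularFormClass.bdd_at_infty g), hg, h⟩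

/-! ### The coface maps on forms with integral expansions

A form `f` of weight `k` is regarded as a function on lattices: its value on the elliptic curve
`ℂ / (ℤ ω₁ + ℤ ω₂)` with invariant differential `dz` is `ω₂ ^ (-k) * f (ω₁ / ω₂)`.
The point `τ` stands for the curve `C = ℂ / (ℤ τ + ℤ)` with the `Γ₀(ℓ)`-structure
`H = ⟨1 / ℓ⟩ = μ_ℓ` (the standard one on the Tate curve). Then
`C / H = ℂ / (ℤ τ + ℤ (1 / ℓ))` and `C / C[ℓ] = ℂ / (ℤ (τ / ℓ) + ℤ (1 / ℓ))`. -/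

/-- The value of the weight `k` form `f` on `(ℂ / (ℤ ω₁ + ℤ ω₂), dz)`. -/
def latticeValue (k : ℤ) (f : ℍ → ℂ) (ω₁ ω₂ : ℂ) : ℂ :=
  ω₂ ^ (-k) * f (ofComplex (ω₁ / ω₂))

/-- The pullback of `f` along `(C, H) ↦ C / H`. -/
def pullQuotSubgroup (l : ℕ) (k : ℤ) (f : ℍ → ℂ) : ℍ → ℂ :=
  fun τ => latticeValue k f τ (1 / l)

/-- The pullback of `f` along `C ↦ C / C[ℓ]`. -/
def pullQuotTorsion (l : ℕ) (k : ℤ) (f : ℍ → ℂ) : ℍ → ℂ :=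
  fun τ => latticeValue k f (τ / l) (1 / l)

/-- The pullback of `f` along `(C, H) ↦ C / H` is `ℓ ^ k f(ℓ τ)`, that is, `ℓ ^ k f(q ^ ℓ)`. -/
lemma pullQuotSubgroup_eq (l : ℕ) [NeZero l] (k : ℕ) (f : ℍ → ℂ) :
    pullQuotSubgroup l k f = (l ^ k : ℕ) • fun τ => f (scal l • τ) := by
  ext τ
  have h : (τ : ℂ) / (1 / l) = ((scal l • τ : ℍ) : ℂ) := by
    rw [scal_smul]
    simp [mul_comm]
  rw [pullQuotSubgroup, latticeValue, h, ofComplex_apply]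
  simp

/-- The pullback of `f` along `C ↦ C / C[ℓ]` is `ℓ ^ k f`. -/
lemma pullQuotTorsion_eq (l : ℕ) [NeZero l] (k : ℕ) (f : ℍ → ℂ) :
    pullQuotTorsion l k f = (l ^ k : ℕ) • f := by
  ext τ
  have h : (τ : ℂ) / l / (1 / l) = τ := by
    have : (l : ℂ) ≠ 0 := NeZero.ne _
    field_simp
  rw [pullQuotTorsion, latticeValue, h, ofComplex_apply]
  simp

/-- `(C, H) ↦ C / H` on forms with integral expansions. -/
def quotSubgroup (l : ℕ) [NeZero l] (k : ℕ) : weakForms 1 k →+ weakForms l k where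
  toFun f := ⟨pullQuotSubgroup l k f, by
    rw [pullQuotSubgroup_eq]
    exact nsmul_mem (comp_scal_mem l k f.2) _⟩
  map_zero' := by
    ext τ
    simp [pullQuotSubgroup, latticeValue]
  map_add' f g := by
    ext τ
    simp [pullQuotSubgroup, latticeValue, mul_add]

/-- `C ↦ C / C[ℓ]` on forms with integral expansions. -/
def quotTorsion (l : ℕ) [NeZero l] (k : ℕ) : weakForms 1 k →+ weakForms 1 k where
  toFun f := ⟨pullQuotTorsion l k f, by
    rw [pullQuotTorsion_eq]
    exact nsmul_mem f.2 _⟩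
  map_zero' := by
    ext τ
    simp [pullQuotTorsion, latticeValue]
  map_add' f g := by
    ext τ
    simp [pullQuotTorsion, latticeValue, mul_add]

/-- `(C, H) ↦ C` on forms with integral expansions: a form of level one, viewed as a form for
`Γ₀(ℓ)`. -/
def forget (l : ℕ) (k : ℕ) : weakForms 1 k →+ weakForms l k :=
  AddSubgroup.inclusion (weakForms_le l k)

/-! ### The complex `C(ℓ)` in degrees `0` and `1`, and its zeroth cohomology modulo `p ^ j` -/

/-- `M_k(Γ₀(N))⁰` over `ℤ_p`. -/
abbrev WeakFormsZp (p : ℕ) [Fact p.Prime] (N k : ℕ) : Type :=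
  ℤ_[p] ⊗[ℤ] weakForms N k

/-- The extension of scalars to `ℤ_p` of an additive map. -/
def extendZp (p : ℕ) [Fact p.Prime] {N N' k : ℕ} (φ : weakForms N k →+ weakForms N' k) :
    WeakFormsZp p N k →ₗ[ℤ_[p]] WeakFormsZp p N' k :=
  φ.toIntLinearMap.baseChange ℤ_[p]

/-- `C(ℓ)^0` in internal degree `2k`. -/
abbrev Cochain0 (p : ℕ) [Fact p.Prime] (k : ℕ) : Type := WeakFormsZp p 1 k

/-- `C(ℓ)^1` in internal degree `2k`. -/
abbrev Cochain1 (p : ℕ) [Fact p.Prime] (l k : ℕ) : Type := WeakFormsZp p l k × WeakFormsZp p 1 k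

/-- The coface map `d_0`, induced by `(C, H) ↦ C / H` and `C ↦ C / C[ℓ]`. -/
def coface0 (p : ℕ) [Fact p.Prime] (l : ℕ) [NeZero l] (k : ℕ) :
    Cochain0 p k →ₗ[ℤ_[p]] Cochain1 p l k :=
  (extendZp p (quotSubgroup l k)).prod (extendZp p (quotTorsion l k))

/-- The coface map `d_1`, induced by `(C, H) ↦ C` and `C ↦ C`. -/
def coface1 (p : ℕ) [Fact p.Prime] (l : ℕ) (k : ℕ) :
    Cochain0 p k →ₗ[ℤ_[p]] Cochain1 p l k :=
  (extendZp p (forget l k)).prod LinearMap.id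

section ModPow

variable (p : ℕ) [Fact p.Prime]

/-- `p ^ j M`. -/
def powSubmodule (M : Type) [AddCommGroup M] [Module ℤ_[p] M] (j : ℕ) : Submodule ℤ_[p] M :=
  LinearMap.range (LinearMap.lsmul ℤ_[p] M ((p : ℤ_[p]) ^ j))

variable {M M' : Type} [AddCommGroup M] [Module ℤ_[p] M] [AddCommGroup M'] [Module ℤ_[p] M']

/-- The map `M / p ^ j → M' / p ^ j` induced by a linear map. -/
def reduceMap (φ : M →ₗ[ℤ_[p]] M') (j : ℕ) :
    (M ⧸ powSubmodule p M j) →ₗ[ℤ_[p]] (M' ⧸ powSubmodule p M' j) :=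
  Submodule.mapQ _ _ φ (by
    rintro _ ⟨x, rfl⟩
    exact ⟨φ x, by simp⟩)

/-- The map `M / p ^ i → M / p ^ j` induced by multiplication by `p ^ (j - i)`, for `i ≤ j`. -/
def shiftMap (M : Type) [AddCommGroup M] [Module ℤ_[p] M] {i j : ℕ} (hij : i ≤ j) :
    (M ⧸ powSubmodule p M i) →ₗ[ℤ_[p]] (M ⧸ powSubmodule p M j) :=
  Submodule.mapQ _ _ (LinearMap.lsmul ℤ_[p] M ((p : ℤ_[p]) ^ (j - i))) (by
    rintro _ ⟨x, rfl⟩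
    refine ⟨x, ?_⟩
    simp only [LinearMap.lsmul_apply, smul_smul, ← pow_add, Nat.sub_add_cancel hij])

lemma reduceMap_shiftMap (φ : M →ₗ[ℤ_[p]] M') {i j : ℕ} (hij : i ≤ j)
    (x : M ⧸ powSubmodule p M i) :
    reduceMap p φ j (shiftMap p M hij x) = shiftMap p M' hij (reduceMap p φ i x) := by
  obtain ⟨y, rfl⟩ := Submodule.Quotient.mk_surjective _ x
  simp [reduceMap, shiftMap]

end ModPow

/-- `A_{t/j} = H^0(C(ℓ) / p ^ j)` in internal degree `2t`: the kernel of
`d_0 - d_1 : C(ℓ)^0 / p ^ j → C(ℓ)^1 / p ^ j`. -/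
def A (p : ℕ) [Fact p.Prime] (l : ℕ) [NeZero l] (t j : ℕ) :
    Submodule ℤ_[p] (Cochain0 p t ⧸ powSubmodule p (Cochain0 p t) j) :=
  LinearMap.ker (reduceMap p (coface0 p l t) j - reduceMap p (coface1 p l t) j)

/-- The transition map `A_{t/i} → A_{t/j}` for `i ≤ j`, induced by multiplication by
`p ^ (j - i)`. -/
def transition (p : ℕ) [Fact p.Prime] (l : ℕ) [NeZero l] (t : ℕ) (i j : ℕ) (hij : i ≤ j) :
    A p l t i →ₗ[ℤ_[p]] A p l t j :=
  (shiftMap p (Cochain0 p t) hij).restrict (by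
    intro x hx
    rw [A, LinearMap.mem_ker, LinearMap.sub_apply] at hx ⊢
    rw [reduceMap_shiftMap, reduceMap_shiftMap, ← map_sub, hx, map_zero])

/-- `A_{t/∞} = colim_j A_{t/j}`. -/
abbrev AInf (p : ℕ) [Fact p.Prime] (l : ℕ) [NeZero l] (t : ℕ) : Type :=
  Module.DirectLimit (fun j : ℕ => A p l t j) (transition p l t)

/-- The canonical map `A_{t/j} → A_{t/∞}`. -/
def toAInf (p : ℕ) [Fact p.Prime] (l : ℕ) [NeZero l] (t j : ℕ) :
    A p l t j →ₗ[ℤ_[p]] AInf p l t :=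
  Module.DirectLimit.of ℤ_[p] ℕ (fun j : ℕ => A p l t j) (transition p l t) j

/-- `e ∈ M_k⁰ ⊗ ℤ_p` is the image of the form `f ∈ M_k⁰ ⊗ ℤ_(p)`: for some `D` prime to `p`, the
form `D f` has integral expansion, and `D e` is the image of `D f`. -/
def IsImageOf {p : ℕ} [Fact p.Prime] {k : ℕ} (e : Cochain0 p k) (f : ℍ → ℂ) : Prop :=
  ∃ D : ℕ, D.Coprime p ∧ ∃ h : D • f ∈ weakForms 1 k,
    (D : ℤ_[p]) • e = (1 : ℤ_[p]) ⊗ₜ[ℤ] (⟨D • f, h⟩ : weakForms 1 k)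

/-- The group `ℤ/p^∞ = ℚ_p / ℤ_p`. -/
abbrev ZModPInf (p : ℕ) [Fact p.Prime] : Type :=
  ℚ_[p] ⧸ (PadicInt.subring p).toAddSubgroup

end QlComplex

end

/-! A class in `A p l t j` is represented by an integral form `w`, because `ℤ` is dense in `ℤ_p`.
Being a cocycle means two congruences modulo `p ^ j`: `l ^ t w(q ^ l) ≡ w(q)` from the `Γ₀(l)`
component and `(l ^ t - 1) w ≡ 0` from the level one component.

Suppose `l ^ t ≡ 1` modulo `p ^ j`. The first congruence makes the Laurent expansion of `w`
invariant under `q ↦ q ^ l`, hence constant (`eq_C_mul_X_pow_of_expand`, `exists_eq_C_mul`).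
Integrality is only asked of expansions at `∞`, so a form whose expansion is divisible by `p ^ j` is
itself divisible (`exists_eq_smul`). Any form with constant expansion modulo `p ^ j`, the constant
being a unit, therefore generates `A p l t j` (`eq_smul_of_mem_A`).

Two valuations agree for `t = (p - 1) p ^ (j - 1) s`. By von Staudt–Clausen `B_t / t` has valuation
`-j`, so `E_t ≡ 1` modulo `p ^ j` and `E_t` is such a generator. Since `l` generates `ℤ_p^×`
topologically, `l ^ t - 1` has valuation exactly `j`. At a level `i ≥ j` the second congruence then
forces `w` to be divisible by `p ^ (i - j)`, so nothing new appears beyond level `j`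
(`transition_surjective`). The order is exactly `p ^ j` because the unit constant term prevents
divisibility by `p` (`IsConstMod.ne_smul`).

In weight `0`, `l ^ 0 = 1` at every level, the constant form `1` generates each `A p l 0 j`, and the
classes `1 / p ^ j` form a Prüfer group. -/

noncomputable section
namespace QlComplex

/-! ### Laurent series invariant under `q ↦ q ^ l` -/

section PowerSeries

open PowerSeries

lemma expand_map {R S : Type*} [CommRing R] [CommRing S] (φ : R →+* S) (l : ℕ) (hl : l ≠ 0)
    (P : PowerSeries R) :
    PowerSeries.map φ (PowerSeries.expand l hl P) = PowerSeries.expand l hl (PowerSeries.map φ P) := by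
  ext m
  simp only [coeff_map, coeff_expand]
  split_ifs <;> simp

/-- A Laurent series `Q / q ^ N` invariant under `q ↦ q ^ l` is constant. -/
lemma eq_C_mul_X_pow_of_expand {R : Type*} [CommRing R] {l : ℕ} (hl : 2 ≤ l) (N : ℕ)
    {Q : PowerSeries R}
    (h : PowerSeries.expand l (by omega) Q * PowerSeries.X ^ N = Q * PowerSeries.X ^ (l * N)) :
    Q = PowerSeries.C (Q.coeff N) * PowerSeries.X ^ N := by
  have key : ∀ i, i ≠ N → Q.coeff i = 0 := by
    intro i
    induction i using Nat.strong_induction_on with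
    | _ i ih =>
      intro hi
      rcases lt_or_gt_of_ne hi with hlt | hgt
      -- Polar part: in this degree the left side shows `Q_i`, and the right side shows the
      -- coefficient of index `l (i - N) + N < i`, or none.
      · have h1 := congrArg (PowerSeries.coeff (l * i + N)) h
        rw [coeff_mul_X_pow, coeff_expand_mul, coeff_mul_X_pow'] at h1
        rw [h1]
        split_ifs with hle
        · have : l * i + N < i + l * N := by nlinarith
          exact ih _ (by omega) (by nlinarith [Nat.sub_add_cancel hle])
        · rfl
      -- Positive part: now the right side shows `Q_i`. The left side vanishes unless `l ∣ i - N`,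
      -- and otherwise shows the index `(i - N) / l + N`, which lies strictly between `N` and `i`.
      · have h1 := congrArg (PowerSeries.coeff (i + l * N)) h
        rw [coeff_mul_X_pow, show i + l * N = (i - N + l * N) + N by omega, coeff_mul_X_pow,
          coeff_expand] at h1
        rw [← h1]
        split_ifs with hd
        · obtain ⟨x, hx⟩ := hd
          have hlN : l ∣ i - N := (Nat.dvd_add_left (dvd_mul_right l N)).mp ⟨x, hx⟩
          obtain ⟨y, hy⟩ := hlN
          have hxy : (i - N + l * N) / l = y + N := by
            rw [hy, ← mul_add, Nat.mul_div_cancel_left _ (by omega)]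
          have hy0 : 0 < y := Nat.pos_of_ne_zero fun h0 => by rw [h0] at hy; omega
          rw [hxy]
          exact ih _ (by nlinarith [Nat.sub_add_cancel hgt.le]) (by omega)
        · rfl
  ext m
  rw [coeff_C_mul, coeff_X_pow]
  split_ifs with hm
  · rw [hm, mul_one]
  · rw [key m hm, mul_zero]

/-- Applied with `X * U` the expansion of `Δ`, so that `G / Δ ^ N` is a weakly holomorphic form. As
`U` is a unit, `Q = G / U ^ N` reduces the claim to a denominator that is a pure power of `X`, but
for an invariant Laurent series in which the factors of `U` cancel. -/
lemma eq_C_mul_pow_of_expand {R : Type*} [CommRing R] {l : ℕ} (hl : 2 ≤ l) (N : ℕ)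
    {G U : PowerSeries R} (hU : IsUnit U)
    (h : PowerSeries.expand l (by omega) G * (PowerSeries.X * U) ^ N =
      G * (PowerSeries.expand l (by omega) (PowerSeries.X * U)) ^ N) :
    ∃ c, G = PowerSeries.C c * (PowerSeries.X * U) ^ N := by
  obtain ⟨V, hV⟩ := hU.exists_left_inv
  have hVN : V ^ N * U ^ N = 1 := by rw [← mul_pow, hV, one_pow]
  have hG : G = U ^ N * (V ^ N * G) := by rw [← mul_assoc, mul_comm (U ^ N), hVN, one_mul]
  generalize V ^ N * G = Q at hG
  subst hG
  have hu : IsUnit (PowerSeries.expand l (by omega) U ^ N * U ^ N) :=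
    ((hU.map (PowerSeries.expand l (by omega))).pow N).mul (hU.pow N)
  refine ⟨Q.coeff N, ?_⟩
  rw [mul_pow, ← mul_assoc, ← eq_C_mul_X_pow_of_expand hl N, mul_comm]
  apply hu.mul_left_cancel
  simp only [map_mul, map_pow, PowerSeries.expand_X, mul_pow, ← pow_mul] at h ⊢
  linear_combination h

end PowerSeries

/-! ### The Prüfer group, and reduction of `ℤ_p ⊗ W` modulo `p ^ j` -/

section PadicInt

variable {p : ℕ} [Fact p.Prime]

lemma isUnit_natCast_of_coprime {D : ℕ} (hD : D.Coprime p) : IsUnit (D : ℤ_[p]) := by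
  rw [PadicInt.isUnit_iff]
  exact PadicInt.norm_natCast_eq_one_iff.mpr hD.symm

/-- A module that is a union of cyclic modules `⟨a 1⟩ ⊆ ⟨a 2⟩ ⊆ ⋯` with `p a (j + 1) = a j`,
`a 0 = 0` and `a 1 ≠ 0` is a Prüfer group. -/
lemma nonempty_addEquiv_ZModPInf {M : Type*} [AddCommGroup M] [Module ℤ_[p] M] (a : ℕ → M)
    (h0 : a 0 = 0) (h1 : a 1 ≠ 0) (hs : ∀ j, (p : ℤ_[p]) • a (j + 1) = a j)
    (hsurj : ∀ x, ∃ (j : ℕ) (c : ℤ_[p]), x = c • a j) : Nonempty (M ≃+ ZModPInf p) := by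
  have hp0 : (p : ℚ_[p]) ≠ 0 := by exact_mod_cast (Fact.out : p.Prime).ne_zero
  have hadd : ∀ j r, (p : ℤ_[p]) ^ r • a (j + r) = a j := by
    intro j r
    induction r with
    | zero => simp
    | succ r ih => rw [pow_succ, mul_smul, ← add_assoc, hs, ih]
  have hex : ∀ x : ℚ_[p], ∃ (j : ℕ) (z : ℤ_[p]), (z : ℚ_[p]) = x * (p : ℚ_[p]) ^ j := by
    intro x
    obtain ⟨j, hj⟩ := exists_nat_gt (-Padic.valuation x)
    refine ⟨j, ⟨x * (p : ℚ_[p]) ^ j, ?_⟩, rfl⟩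
    rcases eq_or_ne x 0 with rfl | hx
    · simp
    rw [Padic.norm_le_one_iff_val_nonneg, Padic.valuation_mul hx (pow_ne_zero _ hp0),
      Padic.valuation_pow, Padic.valuation_p]
    have : -x.valuation < j := by exact_mod_cast hj
    linarith
  choose J Z hZ using hex
  -- The map to be built sends `z / p ^ j` to `z • a j`. Two fractions for the same `x` agree after
  -- both are moved to level `J x + j`.
  have hind : ∀ (x : ℚ_[p]) (j : ℕ) (z : ℤ_[p]), (z : ℚ_[p]) = x * (p : ℚ_[p]) ^ j →
      Z x • a (J x) = z • a j := by
    intro x j z hz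
    rw [← hadd (J x) j, ← hadd j (J x), smul_smul, smul_smul, add_comm j]
    congr 1
    apply Subtype.coe_injective
    push_cast
    rw [hZ, hz]
    ring
  let φ : ℚ_[p] →+ M := AddMonoidHom.mk' (fun x => Z x • a (J x)) (by
    intro x y
    rw [hind (x + y) (J x + J y) (Z x * p ^ J y + Z y * p ^ J x) (by push_cast; rw [hZ, hZ]; ring),
      add_smul, mul_smul, mul_smul, hadd, add_comm (J x), hadd])
  have hφ : ∀ (x : ℚ_[p]) (j : ℕ) (z : ℤ_[p]), (z : ℚ_[p]) = x * (p : ℚ_[p]) ^ j →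
      φ x = z • a j := hind
  have hsur : Function.Surjective φ := by
    intro m
    obtain ⟨j, c, rfl⟩ := hsurj m
    exact ⟨c / (p : ℚ_[p]) ^ j, hφ _ _ _ (by field_simp)⟩
  have hker : (PadicInt.subring p).toAddSubgroup = φ.ker := by
    ext x
    rw [AddMonoidHom.mem_ker]
    constructor
    · intro hx
      obtain ⟨z, hz⟩ : ∃ z : ℤ_[p], (z : ℚ_[p]) = x := ⟨⟨x, hx⟩, rfl⟩
      rw [hφ x 0 z (by simpa using hz), h0, smul_zero]
    · intro hx
      by_contra hn
      have hx0 : x ≠ 0 := by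
        rintro rfl
        exact hn (zero_mem _)
      have hneg : x.valuation < 0 := by
        by_contra! h
        exact hn ((Padic.norm_le_one_iff_val_nonneg x).mpr h)
      -- A non-integral `x` is a unit over `p ^ (n + 1)`. If it were in the kernel, `a (n + 1)`
      -- would vanish, and with it `a 1 = p ^ n • a (n + 1)`.
      obtain ⟨n, hv⟩ : ∃ n : ℕ, x.valuation = -((n + 1 : ℕ) : ℤ) :=
        ⟨(-x.valuation - 1).toNat, by push_cast; omega⟩
      have hy0 : x * (p : ℚ_[p]) ^ (n + 1) ≠ 0 := mul_ne_zero hx0 (pow_ne_zero _ hp0)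
      have hyn : ‖x * (p : ℚ_[p]) ^ (n + 1)‖ = 1 := by
        rw [Padic.norm_eq_zpow_neg_valuation hy0, Padic.valuation_mul hx0 (pow_ne_zero _ hp0),
          Padic.valuation_pow, Padic.valuation_p, hv]
        simp
      obtain ⟨z, hz⟩ : ∃ z : ℤ_[p], (z : ℚ_[p]) = x * (p : ℚ_[p]) ^ (n + 1) :=
        ⟨⟨_, hyn.le⟩, rfl⟩
      have hu : IsUnit z := by rw [PadicInt.isUnit_iff, ← PadicInt.padic_norm_e_of_padicInt, hz, hyn]
      rw [hφ x (n + 1) z hz, hu.smul_eq_zero] at hx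
      apply h1
      rw [← hadd 1 n, add_comm, hx, smul_zero]
  exact ⟨((QuotientAddGroup.quotientAddEquivOfEq hker).trans
    (QuotientAddGroup.quotientKerEquivOfSurjective φ hsur)).symm⟩

variable {W : Type} [AddCommGroup W]

lemma natCast_smul_one_tmul (n : ℕ) (w : W) :
    (n : ℤ_[p]) • ((1 : ℤ_[p]) ⊗ₜ[ℤ] w) = 1 ⊗ₜ[ℤ] (n • w) := by
  rw [Nat.cast_smul_eq_nsmul, ← TensorProduct.tmul_smul]

/-- Each `p`-adic coefficient may be replaced by an integer congruent to it modulo `p ^ j`. This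
lets cocycles be studied on genuine forms. -/
lemma exists_sub_one_tmul_mem (j : ℕ) (x : ℤ_[p] ⊗[ℤ] W) :
    ∃ w : W, x - 1 ⊗ₜ[ℤ] w ∈ powSubmodule p (ℤ_[p] ⊗[ℤ] W) j := by
  induction x with
  | zero => exact ⟨0, by simp⟩
  | add x y hx hy =>
    obtain ⟨v, hv⟩ := hx
    obtain ⟨w, hw⟩ := hy
    refine ⟨v + w, ?_⟩
    rw [TensorProduct.tmul_add, add_sub_add_comm]
    exact add_mem hv hw
  | tmul z w =>
    obtain ⟨y, hy⟩ := Ideal.mem_span_singleton.mp (PadicInt.appr_spec j z)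
    refine ⟨z.appr j • w, y ⊗ₜ w, ?_⟩
    rw [← natCast_smul_one_tmul, LinearMap.lsmul_apply, TensorProduct.smul_tmul',
      TensorProduct.smul_tmul', ← TensorProduct.sub_tmul]
    simp only [smul_eq_mul, mul_one, ← hy]

/-- `W / p ^ j → ℤ_p ⊗ W / p ^ j` is injective. -/
lemma exists_eq_smul_of_one_tmul_mem {j : ℕ} {w : W}
    (h : (1 : ℤ_[p]) ⊗ₜ[ℤ] w ∈ powSubmodule p (ℤ_[p] ⊗[ℤ] W) j) : ∃ v : W, w = p ^ j • v := by
  -- The retraction `z ⊗ w ↦ (z mod p ^ j) w` into `W / p ^ j W` kills multiples of `p ^ j` and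
  -- sends `1 ⊗ w` to the class of `w`.
  let S : AddSubgroup W := (nsmulAddMonoidHom (α := W) (p ^ j)).range
  have hS : ∀ x : W ⧸ S, p ^ j • x = 0 := by
    intro x
    obtain ⟨y, rfl⟩ := QuotientAddGroup.mk_surjective x
    rw [← QuotientAddGroup.mk_nsmul, QuotientAddGroup.eq_zero_iff]
    exact ⟨y, rfl⟩
  let _ : Module (ZMod (p ^ j)) (W ⧸ S) := AddCommGroup.zmodModule hS
  let ψ : ℤ_[p] →+ W →+ W ⧸ S := AddMonoidHom.mk'
    (fun z => (DistribSMul.toAddMonoidHom (W ⧸ S) (PadicInt.toZModPow j z)).comp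
      (QuotientAddGroup.mk' S)) (by
        intro a b
        ext w
        simp [add_smul])
  let Ψ : ℤ_[p] ⊗[ℤ] W →+ W ⧸ S := TensorProduct.liftAddHom ψ (by
    intro n z w
    rw [map_zsmul, map_zsmul]
    rfl)
  obtain ⟨y, hy⟩ := h
  have hkill : ∀ y : ℤ_[p] ⊗[ℤ] W, Ψ ((p : ℤ_[p]) ^ j • y) = 0 := by
    intro y
    rw [← Nat.cast_pow, Nat.cast_smul_eq_nsmul, map_nsmul, hS]
  have h1 : Ψ (1 ⊗ₜ w) = (w : W ⧸ S) := by simp [Ψ, ψ]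
  rw [LinearMap.lsmul_apply] at hy
  rw [← hy, hkill] at h1
  obtain ⟨v, hv⟩ := (QuotientAddGroup.eq_zero_iff w).mp h1.symm
  exact ⟨v, hv.symm⟩

end PadicInt

/-! ### The valuations of `l ^ t - 1` and of `B_t / t` -/

section Arithmetic

variable {p : ℕ} [Fact p.Prime]

/-- Every residue class of units modulo `p ^ n` contains a nonempty open ball, which a dense set of
powers must meet; so the image of `u` generates `(ℤ/p ^ n)^×`. -/
lemma orderOf_toZModPow_of_dense {u : ℤ_[p]ˣ}
    (hgen : Dense ((Subgroup.zpowers u : Subgroup ℤ_[p]ˣ) : Set ℤ_[p]ˣ)) (n : ℕ) :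
    orderOf (Units.map (PadicInt.toZModPow n : ℤ_[p] →+* ZMod (p ^ n)).toMonoidHom u) =
      (p ^ n).totient := by
  have hpp : p.Prime := Fact.out
  have : NeZero (p ^ n) := ⟨pow_ne_zero _ hpp.ne_zero⟩
  rcases Nat.eq_zero_or_pos n with rfl | hn
  · have : Subsingleton (ZMod (p ^ 0)) := by rw [pow_zero]; infer_instance
    rw [Subsingleton.elim (Units.map _ u) 1, orderOf_one]
    simp
  rw [← ZMod.card_units_eq_totient, ← Nat.card_eq_fintype_card]
  refine orderOf_eq_card_of_forall_mem_zpowers fun a => ?_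
  have hcop : (a : ZMod (p ^ n)).val.Coprime p :=
    (Nat.coprime_pow_right_iff hn _ _).mp (ZMod.val_coe_unit_coprime a)
  obtain ⟨w, hw⟩ := isUnit_natCast_of_coprime hcop
  have hpos : (0 : ℝ) < (p : ℝ) ^ (-n : ℤ) := zpow_pos (by exact_mod_cast hpp.pos) _
  have hopen : IsOpen {x : ℤ_[p]ˣ | ‖(x : ℤ_[p]) - w‖ < (p : ℝ) ^ (-n : ℤ)} :=
    isOpen_lt (by fun_prop) continuous_const
  obtain ⟨x, hxu, hx⟩ := hgen.exists_mem_open hopen ⟨w, by simpa using hpos⟩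
  obtain ⟨i, rfl⟩ := Subgroup.mem_zpowers_iff.mp hxu
  refine Subgroup.mem_zpowers_iff.mpr ⟨i, ?_⟩
  have hker := (PadicInt.norm_le_pow_iff_mem_span_pow _ n).mp (le_of_lt hx)
  rw [← PadicInt.ker_toZModPow, RingHom.mem_ker, map_sub, sub_eq_zero, hw, map_natCast,
    ZMod.natCast_zmod_val] at hker
  rw [← map_zpow]
  exact Units.ext hker

/-- If `l` is a topological generator of `ℤ_p^×` and `t = (p - 1) p ^ (j - 1) s` with `s` prime to
`p`, then `l ^ t - 1` is exactly divisible by `p ^ j`. -/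
lemma exists_pow_eq_one_add {l : ℕ} (hl : l ≠ 0) {u : ℤ_[p]ˣ} (hu : (u : ℤ_[p]) = (l : ℤ_[p]))
    (hgen : Dense ((Subgroup.zpowers u : Subgroup ℤ_[p]ˣ) : Set ℤ_[p]ˣ))
    {t j s : ℕ} (hj : 1 ≤ j) (hs : s.Coprime p) (ht : t = (p - 1) * p ^ (j - 1) * s) :
    ∃ m : ℕ, m.Coprime p ∧ l ^ t = 1 + p ^ j * m := by
  have hpp : p.Prime := Fact.out
  have key : ∀ n, p ^ n ∣ l ^ t - 1 ↔ (p ^ n).totient ∣ t := by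
    intro n
    rw [← orderOf_toZModPow_of_dense hgen n, orderOf_dvd_iff_pow_eq_one,
      ← Nat.modEq_iff_dvd' (Nat.one_le_pow _ _ (Nat.pos_of_ne_zero hl)), ← ZMod.natCast_eq_natCast_iff,
      Units.ext_iff, eq_comm]
    simp [hu]
  obtain ⟨m, hm⟩ := (key j).mpr (by
    rw [Nat.totient_prime_pow hpp hj, ht, mul_comm (p - 1)]
    exact dvd_mul_right _ _)
  refine ⟨m, ?_, by have := Nat.one_le_pow t l (Nat.pos_of_ne_zero hl); omega⟩
  rw [Nat.coprime_comm, hpp.coprime_iff_not_dvd]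
  rintro ⟨r, rfl⟩
  -- One more factor `p` would give `(p - 1) p ^ j ∣ t`, hence `p ∣ s`.
  have h1 := (key (j + 1)).mp ⟨r, by rw [hm, pow_succ, mul_assoc]⟩
  obtain ⟨i, rfl⟩ : ∃ i, j = i + 1 := ⟨j - 1, by omega⟩
  rw [Nat.totient_prime_pow hpp (by omega), ht, Nat.add_sub_cancel, Nat.add_sub_cancel, pow_succ,
    show p ^ i * p * (p - 1) = (p - 1) * p ^ i * p by ring] at h1
  have h2 := Nat.dvd_of_mul_dvd_mul_left
    (Nat.mul_pos (Nat.sub_pos_of_lt hpp.one_lt) (Nat.pow_pos hpp.pos)) h1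
  exact hpp.one_lt.ne' (Nat.eq_one_of_dvd_coprimes hs h2 dvd_rfl)

lemma padicNorm_one_div_prime {q : ℕ} (hq : q.Prime) (hqp : q ≠ p) :
    padicNorm p ((1 : ℚ) / q) = 1 := by
  have h : padicNorm p (q : ℚ) = 1 := by
    refine (padicNorm.nat_eq_one_iff q).mpr fun h => hqp ?_
    exact ((Nat.prime_dvd_prime_iff_eq Fact.out hq).mp h).symm
  rw [padicNorm.div, padicNorm.one, h, div_one]

/-- By von Staudt–Clausen, `B_t` is an integer minus the sum of `1 / q` over primes `q` with `q - 1
∣ t`. Only the term `q = p` is not `p`-integral, and it dominates. -/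
lemma padicNorm_bernoulli {t : ℕ} (ht0 : t ≠ 0) (ht2 : Even t) (hpt : p - 1 ∣ t) :
    padicNorm p (bernoulli t) = p := by
  have hpp : p.Prime := Fact.out
  obtain ⟨k, rfl⟩ := even_iff_two_dvd.mp ht2
  obtain ⟨n, hn⟩ := Bernoulli.vonStaudt_clausen k
  have hmem : p ∈ (Finset.range (2 * k + 2)).filter fun q => q.Prime ∧ (q - 1) ∣ 2 * k := by
    have := Nat.le_of_dvd (Nat.pos_of_ne_zero ht0) hpt
    exact Finset.mem_filter.mpr ⟨Finset.mem_range.mpr (by omega), hpp, hpt⟩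
  rw [← Finset.add_sum_erase _ _ hmem] at hn
  set S := ∑ q ∈ ((Finset.range (2 * k + 2)).filter fun q => q.Prime ∧ (q - 1) ∣ 2 * k).erase p,
    (1 : ℚ) / q with hS
  have hS1 : padicNorm p S ≤ 1 := by
    refine padicNorm.sum_le' (fun q hq => ?_) zero_le_one
    rw [Finset.mem_erase, Finset.mem_filter] at hq
    exact (padicNorm_one_div_prime hq.2.2.1 hq.1).le
  have hB : bernoulli (2 * k) = (n - S) + -(1 / (p : ℚ)) := by rw [hn]; ring
  have h1 : padicNorm p ((n : ℚ) - S) ≤ 1 :=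
    padicNorm.sub.trans (max_le (padicNorm.of_int n) hS1)
  have h2 : padicNorm p (-(1 / (p : ℚ))) = p := by
    rw [padicNorm.neg, padicNorm.div, padicNorm.one, padicNorm.padicNorm_p_of_prime]
    simp
  have h3 : (1 : ℚ) < p := by exact_mod_cast hpp.one_lt
  rw [hB, padicNorm.add_eq_max_of_ne (by rw [h2]; exact (h1.trans_lt h3).ne), h2]
  exact max_eq_right (h1.trans h3.le)

lemma padicValNat_den_eq {x : ℚ} {j : ℕ} (hx : padicValRat p x = -j) :
    padicValNat p x.den = j ∧ (0 < j → ¬ p ∣ x.num.natAbs) := by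
  have hpp : p.Prime := Fact.out
  rw [padicValRat] at hx
  by_cases hd : p ∣ x.den
  · have hn : ¬ p ∣ x.num.natAbs := fun h =>
      hpp.one_lt.ne' (Nat.eq_one_of_dvd_coprimes x.reduced h hd)
    have : padicValInt p x.num = 0 := padicValNat.eq_zero_of_not_dvd hn
    exact ⟨by omega, fun _ => hn⟩
  · have := padicValNat.eq_zero_of_not_dvd hd
    exact ⟨by omega, by omega⟩

lemma padicValRat_bernoulli_div {t j s : ℕ} (hp : 3 ≤ p) (hj : 1 ≤ j) (hs : s.Coprime p)
    (ht : t = (p - 1) * p ^ (j - 1) * s) : padicValRat p (bernoulli t / t) = -j := by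
  have hpp : p.Prime := Fact.out
  have hs0 : s ≠ 0 := by
    rintro rfl
    have := (Nat.coprime_zero_left p).mp hs
    omega
  have hpp0 : p ^ (j - 1) ≠ 0 := pow_ne_zero _ hpp.ne_zero
  have ht0 : t ≠ 0 := by
    rw [ht]
    exact mul_ne_zero (mul_ne_zero (by omega) hpp0) hs0
  have ht2 : Even t := by
    rw [ht]
    exact ((hpp.even_sub_one (by omega)).mul_right _).mul_right _
  have hnorm := padicNorm_bernoulli (p := p) ht0 ht2
    (by rw [ht, mul_assoc]; exact dvd_mul_right _ _)
  have hB0 : bernoulli t ≠ 0 := by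
    intro h
    rw [h, padicNorm.zero] at hnorm
    exact hpp.ne_zero (by exact_mod_cast hnorm.symm)
  have hBv : padicValRat p (bernoulli t) = -1 := by
    rw [padicNorm.eq_zpow_of_nonzero hB0] at hnorm
    have := zpow_right_injective₀ (a := (p : ℚ)) (by exact_mod_cast hpp.pos)
      (by exact_mod_cast hpp.one_lt.ne') (hnorm.trans (zpow_one _).symm)
    linarith
  have htv : padicValNat p t = j - 1 := by
    rw [ht, padicValNat.mul (mul_ne_zero (by omega) hpp0) hs0, padicValNat.mul (by omega) hpp0,
      padicValNat.prime_pow, padicValNat.eq_zero_of_not_dvd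
        fun h => by have := Nat.le_of_dvd (by omega) h; omega,
      padicValNat.eq_zero_of_not_dvd fun h => hpp.one_lt.ne' (Nat.eq_one_of_dvd_coprimes hs h dvd_rfl)]
    omega
  rw [padicValRat.div hB0 (by exact_mod_cast ht0), hBv, padicValRat.of_nat, htv]
  omega

end Arithmetic

/-! ### Forms with constant expansion modulo an integer -/

section Forms

/-- `f` is a modular form of weight `k` and level one whose expansion is integral and congruent to
the constant `D` modulo `q`. -/
def IsConstMod (q D : ℕ) (k : ℕ) (f : ℍ → ℂ) : Prop :=
  ∃ g : ModularForm (G0 1) k, ⇑g = f ∧ ∃ P ∈ intSeries,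
    qExpansion 1 g = PowerSeries.C (D : ℂ) + PowerSeries.C (q : ℂ) * P

lemma C_natCast_mem (n : ℕ) : PowerSeries.C (n : ℂ) ∈ intSeries := by
  rw [map_natCast]
  exact natCast_mem _ n

lemma C_intCast_mem (n : ℤ) : PowerSeries.C (n : ℂ) ∈ intSeries := by
  rw [map_intCast]
  exact intCast_mem _ n

lemma coe_mem_weakForms {N : ℕ} {k : ℤ} (g : ModularForm (G0 N) k)
    (hg : qExpansion 1 g ∈ intSeries) : ⇑g ∈ weakForms N k := by
  refine ⟨0, ModularForm.mcast (by simp) g, ?_, fun τ => by simp⟩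
  rw [mem_integralForms, ModularForm.qExpansion_mcast]
  exact hg

lemma IsConstMod.mem_weakForms {q D k : ℕ} {f : ℍ → ℂ} (h : IsConstMod q D k f) :
    f ∈ weakForms 1 k := by
  obtain ⟨g, rfl, P, hP, h⟩ := h
  refine coe_mem_weakForms g ?_
  rw [h]
  exact add_mem (C_natCast_mem D) (mul_mem (C_natCast_mem q) hP)

/-- Weakly holomorphic forms with integral expansions divisible by `q` are divisible by `q`. -/
lemma exists_eq_smul {N q : ℕ} (hq : q ≠ 0) {k : ℤ} (f : ℍ → ℂ) (n : ℕ)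
    (g : ModularForm (G0 N) (k + 12 * n)) (h : ∀ τ, f τ * discriminant τ ^ n = g τ)
    {P : PowerSeries ℂ} (hP : P ∈ intSeries)
    (hg : qExpansion 1 g = PowerSeries.C (q : ℂ) * P) : ∃ v ∈ weakForms N k, f = q • v := by
  have hq' : (q : ℂ) ≠ 0 := by exact_mod_cast hq
  -- The division is done over `ℂ`; only the expansion at `∞` has to remain integral.
  refine ⟨(q : ℂ)⁻¹ • f, ⟨n, (q : ℂ)⁻¹ • g, ?_, fun τ => ?_⟩, ?_⟩
  · rw [mem_integralForms, FunLike.coe_smul, ModularForm.qExpansion_smul one_pos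
      (one_mem_strictPeriods N), hg, ← PowerSeries.smul_eq_C_mul, smul_smul, inv_mul_cancel₀ hq',
      one_smul]
    exact hP
  · rw [FunLike.coe_smul, Pi.smul_apply, Pi.smul_apply, ← h, smul_mul_assoc]
  · ext τ
    simp [hq']

lemma exists_comp_scal (l : ℕ) [NeZero l] {k : ℤ} (g : ModularForm (G0 1) k) :
    ∃ G : ModularForm (G0 l) k, ∀ τ, G τ = g (scal l • τ) := by
  obtain ⟨G, hG⟩ := exists_levelRaise l 0 k g
    (fun γ => g.slash_action_eq' _ ⟨γ, mem_Gamma0_one γ, rfl⟩) g.holo'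
    (by simpa using ModularFormClass.bdd_at_infty g)
  exact ⟨ModularForm.mcast (by simp) G, fun τ => by simpa using hG τ⟩

/-- A form of level one as a form for `Γ₀(l)`. -/
def ofLevelOne (l : ℕ) {k : ℤ} (g : ModularForm (G0 1) k) : ModularForm (G0 l) k :=
  restrict l g (fun γ => g.slash_action_eq' _ ⟨γ, mem_Gamma0_one γ, rfl⟩) g.holo'
    (ModularFormClass.bdd_at_infty g)

lemma qExpansion_comp_scal {l : ℕ} [NeZero l] {k k' : ℤ} {g : ModularForm (G0 1) k}
    {G : ModularForm (G0 l) k'} (h : ∀ τ, G τ = g (scal l • τ)) :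
    qExpansion 1 G = PowerSeries.expand l (NeZero.ne l) (qExpansion 1 g) := by
  ext m
  rw [levelRaise_qExpansion h, PowerSeries.coeff_expand]

/-- If `l ^ k ≡ 1` modulo `q` and `l ^ k w(l τ) ≡ w(τ)`, then `w` is constant modulo `q`. -/
lemma exists_eq_C_mul {l q k : ℕ} [NeZero l] (hl : 2 ≤ l) (hlk : (l ^ k : ℕ) ≡ 1 [MOD q])
    {w v : ℍ → ℂ} (hw : w ∈ weakForms 1 k) (hv : v ∈ weakForms l k)
    (h : ∀ τ, (l : ℂ) ^ k * w (scal l • τ) - w τ = q * v τ) :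
    ∃ (n : ℕ) (g : ModularForm (G0 1) ((k : ℤ) + 12 * n)) (c : ℤ) (P : PowerSeries ℂ),
      (∀ τ, w τ * discriminant τ ^ n = g τ) ∧ P ∈ intSeries ∧
      qExpansion 1 g = PowerSeries.C (c : ℂ) * qExpansion 1 (discriminant : ℍ → ℂ) ^ n +
        PowerSeries.C (q : ℂ) * P := by
  obtain ⟨n₁, g₁, hg₁, hw⟩ := hw
  obtain ⟨n₂, h₂, hh₂, hv⟩ := hv
  obtain ⟨g, hg, hgw⟩ := exists_mul_discriminant hg₁ n₂ (k' := k + 12 * (n₁ + n₂ : ℕ))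
    (by push_cast; ring)
  obtain ⟨f, hf, hfv⟩ := exists_mul_discriminant hh₂ n₁ (k' := k + 12 * (n₁ + n₂ : ℕ))
    (by push_cast; ring)
  replace hgw : ∀ τ, w τ * discriminant τ ^ (n₁ + n₂) = g τ := fun τ => by
    rw [hgw, ← hw]; ring
  replace hfv : ∀ τ, v τ * discriminant τ ^ (n₁ + n₂) = f τ := fun τ => by
    rw [hfv, ← hv]; ring
  generalize n₁ + n₂ = n at g f hg hf hgw hfv
  obtain ⟨G, hG⟩ := exists_comp_scal l g
  obtain ⟨D, hD⟩ := exists_comp_scal l (deltaForm 1)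
  -- The hypothesis multiplied by `Δ(τ) ^ n Δ(l τ) ^ n`, which clears the poles of both `w(τ)` and
  -- `w(l τ)` and leaves an identity of modular forms for `Γ₀(l)`.
  have hfun : (l : ℂ) ^ k • (G.mul ((deltaForm l).pow n)) =
      (ofLevelOne l g).mul (D.pow n) + (q : ℂ) • f.mul (D.pow n) := by
    ext τ
    have e1 : deltaForm l τ = discriminant τ := rfl
    have e2 : ofLevelOne l g τ = g τ := rfl
    have e3 : deltaForm 1 (scal l • τ) = discriminant (scal l • τ) := rfl
    simp only [FunLike.coe_smul, FunLike.coe_add, Pi.smul_apply, Pi.add_apply, ModularForm.coe_mul,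
      Pi.mul_apply, ModularForm.coe_pow, Pi.pow_apply, smul_eq_mul, e1, e2, hD, hG, e3, ← hgw,
      ← hfv]
    linear_combination discriminant τ ^ n * discriminant (scal l • τ) ^ n * h τ
  have hper := one_mem_strictPeriods l
  have hq : qExpansion 1 ⇑((l : ℂ) ^ k • (G.mul ((deltaForm l).pow n))) =
      qExpansion 1 ⇑((ofLevelOne l g).mul (D.pow n) + (q : ℂ) • f.mul (D.pow n)) := by rw [hfun]
  rw [FunLike.coe_add, ModularForm.qExpansion_add one_pos hper, FunLike.coe_smul,
    FunLike.coe_smul, ModularForm.qExpansion_smul one_pos hper,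
    ModularForm.qExpansion_smul one_pos hper] at hq
  simp only [ModularForm.qExpansion_mul one_pos hper, ModularForm.qExpansion_pow one_pos hper,
    qExpansion_comp_scal hG, qExpansion_comp_scal hD, PowerSeries.smul_eq_C_mul] at hq
  have e1 : qExpansion 1 (deltaForm l) = qExpansion 1 (discriminant : ℍ → ℂ) := rfl
  have e2 : qExpansion 1 (ofLevelOne l g) = qExpansion 1 g := rfl
  have e3 : qExpansion 1 (deltaForm 1) = qExpansion 1 (discriminant : ℍ → ℂ) := rfl
  rw [e1, e2, e3] at hq
  obtain ⟨U, ⟨U, rfl⟩, hU1, hUΔ⟩ := discriminant_qExpansion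
  obtain ⟨g', hg'⟩ := mem_integralForms.mp hg
  obtain ⟨f', hf'⟩ := mem_integralForms.mp hf
  have hinj : Function.Injective (PowerSeries.map (Int.castRingHom ℂ)) :=
    PowerSeries.map_injective _ Int.cast_injective
  have hUunit : IsUnit U := by
    rw [PowerSeries.isUnit_iff_constantCoeff]
    have : ((PowerSeries.constantCoeff U : ℤ) : ℂ) = 1 := by
      rw [← PowerSeries.coeff_zero_eq_constantCoeff_apply] at hU1 ⊢
      rwa [PowerSeries.coeff_map] at hU1
    rw [show PowerSeries.constantCoeff U = 1 by exact_mod_cast this]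
    exact isUnit_one
  have hZ : PowerSeries.C ((l : ℤ) ^ k) * (PowerSeries.expand l (NeZero.ne l) g' *
      (PowerSeries.X * U) ^ n) = g' * (PowerSeries.expand l (NeZero.ne l) (PowerSeries.X * U)) ^ n +
      PowerSeries.C (q : ℤ) * (f' * (PowerSeries.expand l (NeZero.ne l) (PowerSeries.X * U)) ^ n) := by
    apply hinj
    rw [hUΔ, ← hg', ← hf', ← PowerSeries.map_X (Int.castRingHom ℂ), ← map_mul] at hq
    simp only [← expand_map, ← map_pow, ← map_mul] at hq
    simpa using hq
  -- Modulo `q` the factor `l ^ k` becomes `1` and the term with `v` disappears, leaving exact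
  -- invariance under `q ↦ q ^ l`.
  have hq1 := congrArg (PowerSeries.map (Int.castRingHom (ZMod q))) hZ
  have hlk' : (l : ZMod q) ^ k = 1 := by
    have := (ZMod.natCast_eq_natCast_iff _ _ _).mpr hlk
    simpa using this
  simp only [map_add, map_mul (PowerSeries.map _), map_pow (PowerSeries.map _), PowerSeries.map_C,
    expand_map] at hq1
  simp only [eq_intCast, Int.cast_pow, Int.cast_natCast, hlk', ZMod.natCast_self, map_one, map_zero,
    one_mul, zero_mul, add_zero, PowerSeries.map_X] at hq1
  obtain ⟨c, hc⟩ := eq_C_mul_pow_of_expand hl n (hUunit.map _) hq1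
  obtain ⟨c, rfl⟩ := ZMod.intCast_surjective c
  have hdvd : ∀ m, ∃ b : ℤ, (g' - PowerSeries.C c * (PowerSeries.X * U) ^ n).coeff m = q * b := by
    intro m
    rw [← dvd_def, ← ZMod.intCast_zmod_eq_zero_iff_dvd, ← eq_intCast (Int.castRingHom (ZMod q)),
      ← PowerSeries.coeff_map, map_sub, hc]
    simp
  choose b hb using hdvd
  have hgb : g' = PowerSeries.C c * (PowerSeries.X * U) ^ n +
      PowerSeries.C (q : ℤ) * PowerSeries.mk b := by
    rw [← sub_eq_iff_eq_add']
    ext m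
    rw [hb, PowerSeries.coeff_C_mul, PowerSeries.coeff_mk]
  refine ⟨n, g, c, PowerSeries.map (Int.castRingHom ℂ) (PowerSeries.mk b), hgw, ⟨_, rfl⟩, ?_⟩
  rw [← hg', hgb, hUΔ]
  simp

/-- A form that is invariant modulo `q` is a multiple of a form that is constant modulo `q`. -/
lemma IsConstMod.exists_smul_sub_eq {l q k D : ℕ} [NeZero l] (hq : q ≠ 0) (hl : 2 ≤ l)
    (hlk : (l ^ k : ℕ) ≡ 1 [MOD q]) {e w v : ℍ → ℂ} (he : IsConstMod q D k e)
    (hw : w ∈ weakForms 1 k) (hv : v ∈ weakForms l k)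
    (h : ∀ τ, (l : ℂ) ^ k * w (scal l • τ) - w τ = q * v τ) :
    ∃ c : ℤ, ∃ v' ∈ weakForms 1 k, D • w - c • e = q • v' := by
  obtain ⟨n, g, c, P, hgw, hP, hg⟩ := exists_eq_C_mul hl hlk hw hv h
  obtain ⟨E, rfl, Q, hQ, hE⟩ := he
  let E' : ModularForm (G0 1) ((k : ℤ) + 12 * n) :=
    ModularForm.mcast (by ring) (E.mul ((deltaForm 1).pow n))
  have hδ : qExpansion 1 (deltaForm 1) = qExpansion 1 (discriminant : ℍ → ℂ) := rfl
  have hper := one_mem_strictPeriods 1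
  have hE' : qExpansion 1 E' = qExpansion 1 E * qExpansion 1 (discriminant : ℍ → ℂ) ^ n := by
    rw [ModularForm.qExpansion_mcast, ModularForm.qExpansion_mul one_pos hper,
      ModularForm.qExpansion_pow one_pos hper, hδ]
  -- Modulo `q`, `g` is `c Δ ^ n` and `E'` is `D Δ ^ n`, so the leading parts cancel in `D g - c
  -- E'`.
  refine ⟨c, exists_eq_smul hq _ n ((D : ℂ) • g - (c : ℂ) • E') (fun τ => ?_)
    (P := PowerSeries.C (D : ℂ) * P -
      PowerSeries.C (c : ℂ) * (Q * qExpansion 1 (discriminant : ℍ → ℂ) ^ n)) ?_ ?_⟩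
  · have e1 : E' τ = E τ * discriminant τ ^ n := by
      rw [ModularForm.coe_mcast, ModularForm.coe_mul, Pi.mul_apply, ModularForm.coe_pow]
      rfl
    simp only [FunLike.coe_sub, FunLike.coe_smul, Pi.sub_apply, Pi.smul_apply, e1, ← hgw]
    simp only [nsmul_eq_mul, zsmul_eq_mul, smul_eq_mul]
    ring
  · exact sub_mem (mul_mem (C_natCast_mem D) hP)
      (mul_mem (C_intCast_mem c) (mul_mem hQ (pow_mem discriminant_mem_intSeries n)))
  · rw [FunLike.coe_sub, ModularForm.qExpansion_sub one_pos hper, FunLike.coe_smul,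
      FunLike.coe_smul, ModularForm.qExpansion_smul one_pos hper,
      ModularForm.qExpansion_smul one_pos hper, hE', hg, hE, PowerSeries.smul_eq_C_mul,
      PowerSeries.smul_eq_C_mul]
    ring

/-- A form that is constant modulo `q` is invariant modulo `q`. -/
lemma IsConstMod.invariant {l q k D : ℕ} [NeZero l] (hq : q ≠ 0)
    (hlk : (l ^ k : ℕ) ≡ 1 [MOD q]) {e : ℍ → ℂ} (he : IsConstMod q D k e) :
    ∃ v ∈ weakForms l k, (l ^ k : ℕ) • (fun τ => e (scal l • τ)) - e = q • v := by
  obtain ⟨E, rfl, Q, ⟨Q, rfl⟩, hE⟩ := he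
  obtain ⟨G, hG⟩ := exists_comp_scal l E
  -- Substituting `q ↦ q ^ l` fixes the constant `D`, so the constants contribute `(l ^ k - 1) D = q
  -- b D`.
  obtain ⟨b, hb⟩ : ∃ b : ℤ, ((l ^ k : ℕ) : ℤ) = 1 + q * b := by
    obtain ⟨b, hb⟩ := (Nat.modEq_iff_dvd.mp hlk.symm)
    push_cast at hb ⊢
    exact ⟨b, by linarith⟩
  have hb' : (l : ℂ) ^ k = 1 + q * b := by exact_mod_cast congrArg (Int.cast : ℤ → ℂ) hb
  have hper := one_mem_strictPeriods l
  refine exists_eq_smul hq _ 0 (ModularForm.mcast (by simp) ((l : ℂ) ^ k • G - ofLevelOne l E))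
    (fun τ => ?_) (P := PowerSeries.C (b : ℂ) * PowerSeries.C (D : ℂ) +
      (PowerSeries.C (l : ℂ) ^ k * PowerSeries.expand l (NeZero.ne l)
        (PowerSeries.map (Int.castRingHom ℂ) Q) - PowerSeries.map (Int.castRingHom ℂ) Q)) ?_ ?_
  · have e2 : ofLevelOne l E τ = E τ := rfl
    simp [hG, e2]
  · refine add_mem (mul_mem (C_intCast_mem b) (C_natCast_mem D)) (sub_mem (mul_mem
      (pow_mem (C_natCast_mem l) k) ⟨PowerSeries.expand l (NeZero.ne l) Q, ?_⟩) ⟨Q, rfl⟩)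
    exact expand_map _ _ _ _
  · have e2 : qExpansion 1 (ofLevelOne l E) = qExpansion 1 E := rfl
    have e3 := congrArg (PowerSeries.C (R := ℂ)) hb'
    rw [map_add, map_mul, map_one, map_pow] at e3
    rw [ModularForm.qExpansion_mcast, FunLike.coe_sub, ModularForm.qExpansion_sub one_pos hper,
      FunLike.coe_smul, ModularForm.qExpansion_smul one_pos hper, qExpansion_comp_scal hG, e2, hE,
      PowerSeries.smul_eq_C_mul, map_add, map_mul, PowerSeries.expand_C, PowerSeries.expand_C,
      map_pow]
    linear_combination PowerSeries.C (D : ℂ) * e3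

/-- A form that is constant modulo `p`, with constant prime to `p`, is not divisible by `p`. -/
lemma IsConstMod.ne_smul {p q k D : ℕ} (hp : p.Prime) (hpq : p ∣ q) (hD : D.Coprime p) {e v : ℍ → ℂ}
    (he : IsConstMod q D k e) (hv : v ∈ weakForms 1 k) : e ≠ p • v := by
  intro hev
  obtain ⟨E, rfl, Q, hQ, hE⟩ := he
  obtain ⟨n, g, hg, hvg⟩ := hv
  have hper := one_mem_strictPeriods 1
  have hfun : (p : ℂ) • g = ModularForm.mcast (by ring) (E.mul ((deltaForm 1).pow n)) := by
    ext τ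
    have e1 : deltaForm 1 τ = discriminant τ := rfl
    simp only [FunLike.coe_smul, ModularForm.coe_mcast, ModularForm.coe_mul, ModularForm.coe_pow,
      Pi.smul_apply, Pi.mul_apply, Pi.pow_apply, hev, e1, ← hvg]
    simp only [nsmul_eq_mul, smul_eq_mul]
    ring
  have hδ : qExpansion 1 (deltaForm 1) = qExpansion 1 (discriminant : ℍ → ℂ) := rfl
  obtain ⟨U, hU, hU1, hUΔ⟩ := discriminant_qExpansion
  -- `Δ ^ n` starts with `X ^ n` with coefficient `1`, so the coefficient of index `n` of `E Δ ^ n`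
  -- is the constant term of `E`. This would give `p ∣ D`.
  have h1 := congrArg (fun F : ModularForm _ _ => (qExpansion 1 F).coeff n) hfun
  simp only [FunLike.coe_smul] at h1
  rw [ModularForm.qExpansion_smul one_pos hper, ModularForm.qExpansion_mcast,
    ModularForm.qExpansion_mul one_pos hper, ModularForm.qExpansion_pow one_pos hper, hδ, hUΔ, hE,
    mul_pow, mul_left_comm, PowerSeries.coeff_X_pow_mul', if_pos le_rfl, Nat.sub_self,
    PowerSeries.coeff_zero_eq_constantCoeff_apply] at h1
  obtain ⟨a, ha⟩ := hg n
  obtain ⟨b, hb⟩ := mem_intSeries.mp hQ 0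
  rw [PowerSeries.coeff_zero_eq_constantCoeff_apply] at hb
  rw [PowerSeries.coeff_smul, ha, map_mul, map_pow, hU1, map_add, map_mul, PowerSeries.constantCoeff_C,
    PowerSeries.constantCoeff_C, hb, one_pow, mul_one, smul_eq_mul] at h1
  have h2 : (p : ℤ) * a = D + q * b := by exact_mod_cast h1
  have h3 : (p : ℤ) ∣ D := by
    rw [show (D : ℤ) = p * a - q * b by linarith]
    exact dvd_sub (dvd_mul_right _ _) (Dvd.dvd.mul_right (by exact_mod_cast hpq) _)
  exact hp.one_lt.ne' (Nat.eq_one_of_dvd_coprimes hD (by exact_mod_cast h3) dvd_rfl)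

lemma isConstMod_one (q : ℕ) : IsConstMod q 1 0 1 := by
  refine ⟨restrict 1 1 ?_ mdifferentiable_const ?_, rfl, 0, zero_mem _, ?_⟩
  · intro γ
    exact (1 : ModularForm 𝒮ℒ 0).slash_action_eq' _ ⟨γ, rfl⟩
  · exact ModularFormClass.bdd_at_infty (1 : ModularForm 𝒮ℒ 0)
  · rw [show ⇑(restrict 1 1 _ _ _ : ModularForm (G0 1) ((0 : ℕ) : ℤ)) = 1 from rfl,
      UpperHalfPlane.qExpansion_one]
    simp

/-- The Eisenstein series `E_t` is `p`-integral and congruent to `1` modulo `p ^ j`, if `p ^ j`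
is the exact power of `p` in the denominator of `B_t / t`. -/
lemma exists_isConstMod_E {p t j : ℕ} [Fact p.Prime] (hj : 1 ≤ j) (ht3 : 3 ≤ t) (ht2 : Even t)
    (hv : padicValRat p (bernoulli t / t) = -j) :
    ∃ D : ℕ, D.Coprime p ∧ IsConstMod (p ^ j) D t (D • ⇑(E ht3)) := by
  have hpp : p.Prime := Fact.out
  obtain ⟨hden, hnum⟩ := padicValNat_den_eq hv
  set x : ℚ := bernoulli t / t with hx
  have hnum := hnum hj
  have hx0 : x.num ≠ 0 := by
    intro h
    simp [h] at hnum
  obtain ⟨m, hm⟩ : p ^ j ∣ x.den := by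
    have := pow_padicValNat_dvd (p := p) (n := x.den)
    rwa [hden] at this
  -- With `x = B_t / t`, the coefficient `2t / B_t` is `2 x.den / x.num`. Thus `D = |x.num|` clears
  -- denominators and is prime to `p`, while `x.den` supplies the factor `p ^ j`.
  have hcoef : (x.num : ℂ) * (2 * t / bernoulli t) = 2 * x.den := by
    have ht0 : (t : ℚ) ≠ 0 := by exact_mod_cast (by omega : t ≠ 0)
    have hB : bernoulli t ≠ 0 := by
      intro h
      rw [h, zero_div] at hx
      simp [hx] at hx0
    have hd : (x.den : ℚ) ≠ 0 := by exact_mod_cast x.den_ne_zero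
    have h1 : (x.num : ℚ) * (2 * t / bernoulli t) = 2 * x.den := by
      have h2 : (x.num : ℚ) = bernoulli t / t * x.den := by
        rw [← hx]
        exact (Rat.mul_den_eq_num x).symm
      rw [h2]
      field_simp
    exact_mod_cast congrArg (Rat.cast : ℚ → ℂ) h1
  obtain ⟨ε, hε⟩ : ∃ ε : ℤ, (x.num.natAbs : ℤ) = ε * x.num := by
    rcases Int.natAbs_eq x.num with h | h
    · exact ⟨1, by omega⟩
    · exact ⟨-1, by omega⟩
  have hε' : (x.num.natAbs : ℂ) = ε * x.num := by
    have := congrArg (Int.cast : ℤ → ℂ) hε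
    rwa [Int.cast_natCast, Int.cast_mul] at this
  let E₁ : ModularForm (G0 1) t := restrict 1 (E ht3)
    (fun γ => (E ht3).slash_action_eq' _ ⟨γ, rfl⟩) (E ht3).holo'
    (ModularFormClass.bdd_at_infty (E ht3))
  have hE₁ : qExpansion 1 E₁ = qExpansion 1 (E ht3) := rfl
  refine ⟨x.num.natAbs, ((hpp.coprime_iff_not_dvd).mpr hnum).symm,
    (x.num.natAbs : ℂ) • E₁, ?_, -(PowerSeries.C ((ε * 2 * m : ℤ) : ℂ) * sigmaSeries (t - 1)),
    neg_mem (mul_mem (C_intCast_mem _) (sigmaSeries_mem _)), ?_⟩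
  · ext τ
    have e1 : E₁ τ = E ht3 τ := rfl
    rw [FunLike.coe_smul, Pi.smul_apply, Pi.smul_apply, e1]
    simp
  · have e1 : (x.num.natAbs : ℂ) * -(2 * t / bernoulli t) = -((p ^ j : ℕ) * (ε * 2 * m : ℤ)) := by
      have e2 : (x.den : ℂ) = (p ^ j : ℕ) * m := by exact_mod_cast congrArg (Nat.cast : ℕ → ℂ) hm
      rw [hε']
      push_cast at e2 ⊢
      linear_combination -ε * hcoef - 2 * ε * e2
    rw [FunLike.coe_smul, ModularForm.qExpansion_smul one_pos (one_mem_strictPeriods 1), hE₁,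
      E_qExpansion_eq ht3 ht2, PowerSeries.smul_eq_C_mul, mul_add, ← mul_assoc, ← map_mul, e1,
      map_neg, map_mul]
    ring

end Forms

/-! ### Cocycles modulo `p ^ j` -/

section Cohomology

variable {p : ℕ} [Fact p.Prime]

lemma mem_powSubmodule_smul_iff {M : Type} [AddCommGroup M] [Module ℤ_[p] M] {j : ℕ} {D : ℕ}
    (hD : D.Coprime p) {x : M} : (D : ℤ_[p]) • x ∈ powSubmodule p M j ↔ x ∈ powSubmodule p M j :=
  Submodule.smul_mem_iff_of_isUnit _ (isUnit_natCast_of_coprime hD)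

lemma mk_mem_A {l : ℕ} [NeZero l] {t j : ℕ} {x : Cochain0 p t} :
    Submodule.Quotient.mk x ∈ A p l t j ↔
      extendZp p (quotSubgroup l t) x - extendZp p (forget l t) x ∈ powSubmodule p _ j ∧
      extendZp p (quotTorsion l t) x - x ∈ powSubmodule p _ j := by
  have : Submodule.Quotient.mk x ∈ A p l t j ↔
      coface0 p l t x - coface1 p l t x ∈ powSubmodule p (Cochain1 p l t) j := by
    rw [A, LinearMap.mem_ker, LinearMap.sub_apply, reduceMap, reduceMap, Submodule.mapQ_apply,
      Submodule.mapQ_apply, ← Submodule.Quotient.mk_sub, Submodule.Quotient.mk_eq_zero]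
  rw [this]
  constructor
  · rintro ⟨y, hy⟩
    exact ⟨⟨y.1, congrArg Prod.fst hy⟩, ⟨y.2, congrArg Prod.snd hy⟩⟩
  · rintro ⟨⟨y, hy⟩, ⟨z, hz⟩⟩
    exact ⟨(y, z), Prod.ext hy hz⟩

lemma extendZp_one_tmul {N N' k : ℕ} (φ : weakForms N k →+ weakForms N' k) (w : weakForms N k) :
    extendZp p φ (1 ⊗ₜ w) = 1 ⊗ₜ φ w := by
  simp [extendZp]

lemma one_tmul_mem_powSubmodule {W : Type} [AddCommGroup W] {j : ℕ} {w : W} :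
    (1 : ℤ_[p]) ⊗ₜ[ℤ] w ∈ powSubmodule p (ℤ_[p] ⊗[ℤ] W) j ↔ ∃ v : W, w = p ^ j • v := by
  refine ⟨exists_eq_smul_of_one_tmul_mem, ?_⟩
  rintro ⟨v, rfl⟩
  refine ⟨1 ⊗ₜ v, ?_⟩
  rw [LinearMap.lsmul_apply, ← Nat.cast_pow, natCast_smul_one_tmul]

/-- The working form of the cocycle condition: since `W / p ^ j` injects into `ℤ_p ⊗ W / p ^ j`, it
can be read off on functions on the upper half plane. -/
lemma mk_one_tmul_mem_A {l : ℕ} [NeZero l] {t j : ℕ} {w : weakForms 1 t} :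
    Submodule.Quotient.mk ((1 : ℤ_[p]) ⊗ₜ[ℤ] w) ∈ A p l t j ↔
      (∃ v ∈ weakForms l t,
        (l ^ t : ℕ) • (fun τ => (w : ℍ → ℂ) (scal l • τ)) - (w : ℍ → ℂ) = p ^ j • v) ∧
      (∃ v ∈ weakForms 1 t, (l ^ t : ℕ) • (w : ℍ → ℂ) - (w : ℍ → ℂ) = p ^ j • v) := by
  rw [mk_mem_A, extendZp_one_tmul, extendZp_one_tmul, extendZp_one_tmul, ← TensorProduct.tmul_sub,
    ← TensorProduct.tmul_sub, one_tmul_mem_powSubmodule, one_tmul_mem_powSubmodule,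
    ← pullQuotSubgroup_eq, ← pullQuotTorsion_eq]
  simp only [Subtype.ext_iff]
  exact and_congr ⟨fun ⟨v, hv⟩ => ⟨v, v.2, hv⟩, fun ⟨v, hv, h⟩ => ⟨⟨v, hv⟩, h⟩⟩
    ⟨fun ⟨v, hv⟩ => ⟨v, v.2, hv⟩, fun ⟨v, hv, h⟩ => ⟨⟨v, hv⟩, h⟩⟩

variable {l : ℕ} [NeZero l] {t j D : ℕ} {E' : weakForms 1 t} {e : Cochain0 p t}

/-- Here and below `e` stands for `E' / D`. As `D` is a unit of `ℤ_p`, questions about `e` become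
questions about the integral form `E'`. -/
lemma mk_mem_A_of_isConstMod (hD : D.Coprime p) (hE : IsConstMod (p ^ j) D t E')
    (he : (D : ℤ_[p]) • e = 1 ⊗ₜ E') (hlt : (l ^ t : ℕ) ≡ 1 [MOD p ^ j]) :
    Submodule.Quotient.mk e ∈ A p l t j := by
  have hp0 : p ^ j ≠ 0 := pow_ne_zero _ (Fact.out : p.Prime).ne_zero
  have h := mk_one_tmul_mem_A (p := p) (l := l) (t := t) (j := j) (w := E')
  rw [← he, Submodule.Quotient.mk_smul,
    Submodule.smul_mem_iff_of_isUnit _ (isUnit_natCast_of_coprime hD)] at h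
  refine h.mpr ⟨hE.invariant hp0 hlt, ?_⟩
  obtain ⟨b, hb⟩ := Nat.modEq_iff_dvd.mp hlt.symm
  refine ⟨b • (E' : ℍ → ℂ), zsmul_mem E'.2 b, ?_⟩
  rw [← natCast_zsmul, ← natCast_zsmul, smul_smul, ← hb, sub_smul, Nat.cast_one, one_smul]

lemma exists_eq_smul_mk (hl : 2 ≤ l) (hD : D.Coprime p) (hE : IsConstMod (p ^ j) D t E')
    (he : (D : ℤ_[p]) • e = 1 ⊗ₜ E') (hlt : (l ^ t : ℕ) ≡ 1 [MOD p ^ j])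
    {w : weakForms 1 t} {v : ℍ → ℂ} (hv : v ∈ weakForms l t)
    (h : (l ^ t : ℕ) • (fun τ => (w : ℍ → ℂ) (scal l • τ)) - (w : ℍ → ℂ) = p ^ j • v) :
    ∃ c : ℤ, (1 : ℤ_[p]) ⊗ₜ w - c • e ∈ powSubmodule p (Cochain0 p t) j := by
  have hp0 : p ^ j ≠ 0 := pow_ne_zero _ (Fact.out : p.Prime).ne_zero
  obtain ⟨c, v', hv', hc⟩ := hE.exists_smul_sub_eq hp0 hl hlt w.2 hv
    (fun τ => by simpa using congrFun h τ)
  refine ⟨c, ?_⟩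
  rw [← mem_powSubmodule_smul_iff hD, smul_sub, natCast_smul_one_tmul, smul_comm, he,
    ← TensorProduct.tmul_smul, ← TensorProduct.tmul_sub]
  exact one_tmul_mem_powSubmodule.mpr ⟨⟨v', hv'⟩, Subtype.ext hc⟩

lemma exists_mk_one_tmul_eq {W : Type} [AddCommGroup W] (j : ℕ)
    (x : (ℤ_[p] ⊗[ℤ] W) ⧸ powSubmodule p (ℤ_[p] ⊗[ℤ] W) j) :
    ∃ w : W, Submodule.Quotient.mk ((1 : ℤ_[p]) ⊗ₜ[ℤ] w) = x := by
  obtain ⟨y, rfl⟩ := Submodule.Quotient.mk_surjective _ x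
  obtain ⟨w, hw⟩ := exists_sub_one_tmul_mem j y
  exact ⟨w, ((Submodule.Quotient.eq _).mpr hw).symm⟩

/-- Only the `Γ₀(l)` component of the cocycle condition matters here, the other one being automatic
when `l ^ t ≡ 1`. -/
lemma eq_smul_of_mem_A (hl : 2 ≤ l) (hD : D.Coprime p) (hE : IsConstMod (p ^ j) D t E')
    (he : (D : ℤ_[p]) • e = 1 ⊗ₜ E') (hlt : (l ^ t : ℕ) ≡ 1 [MOD p ^ j])
    (he' : Submodule.Quotient.mk e ∈ A p l t j) (x : A p l t j) :
    ∃ c : ℤ, x = c • (⟨Submodule.Quotient.mk e, he'⟩ : A p l t j) := by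
  obtain ⟨x, hx⟩ := x
  obtain ⟨w, rfl⟩ := exists_mk_one_tmul_eq j x
  obtain ⟨⟨v, hv, h⟩, -⟩ := mk_one_tmul_mem_A.mp hx
  obtain ⟨c, hc⟩ := exists_eq_smul_mk hl hD hE he hlt hv h
  exact ⟨c, Subtype.ext ((Submodule.Quotient.eq _).mpr hc)⟩

/-! ### The colimit over `j` -/

lemma transition_mk {i : ℕ} (hij : i ≤ j) {x : Cochain0 p t}
    (hx : Submodule.Quotient.mk x ∈ A p l t i) :
    (transition p l t i j hij ⟨Submodule.Quotient.mk x, hx⟩ : Cochain0 p t ⧸ powSubmodule p _ j) =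
      Submodule.Quotient.mk ((p : ℤ_[p]) ^ (j - i) • x) := rfl

instance directedSystem_A (p : ℕ) [Fact p.Prime] (l : ℕ) [NeZero l] (t : ℕ) :
    DirectedSystem (fun j => A p l t j) (fun i j h => transition p l t i j h) where
  map_self := by
    rintro i ⟨x, hx⟩
    obtain ⟨y, rfl⟩ := Submodule.Quotient.mk_surjective _ x
    refine Subtype.ext ?_
    rw [transition_mk]
    simp
  map_map := by
    rintro k j i hij hjk ⟨x, hx⟩
    obtain ⟨y, rfl⟩ := Submodule.Quotient.mk_surjective _ x
    refine Subtype.ext ?_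
    rw [transition_mk]
    change Submodule.Quotient.mk ((p : ℤ_[p]) ^ (k - j) • (p : ℤ_[p]) ^ (j - i) • y) = _
    rw [smul_smul, ← pow_add]
    congr 3
    omega

/-- If `p ^ j` is the exact power of `p` dividing `l ^ t - 1`, then `A_{t/j} → A_{t/i}` is
surjective for `i ≥ j`. -/
lemma transition_surjective {i m : ℕ} (hji : j ≤ i) (hm : m.Coprime p) (hlt : l ^ t = 1 + p ^ j * m) :
    Function.Surjective (transition p l t j i hji) := by
  have hpp : p.Prime := Fact.out
  have hp0 : p ≠ 0 := hpp.ne_zero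
  have hi : p ^ i = p ^ (i - j) * p ^ j := by rw [← pow_add, Nat.sub_add_cancel hji]
  rintro ⟨x, hx⟩
  obtain ⟨w, rfl⟩ := exists_mk_one_tmul_eq i x
  obtain ⟨⟨v₁, hv₁, h₁⟩, v₂, hv₂, h₂⟩ := mk_one_tmul_mem_A.mp hx
  have hcancel : ∀ (n : ℕ) {x y : ℍ → ℂ}, p ^ n • x = p ^ n • y → x = y := fun n _ _ h =>
    smul_right_injective _ (pow_ne_zero n hp0) h
  -- The level one component reads `p ^ j m w = p ^ i v₂`; functions have no torsion, so `p ^ j`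
  -- cancels.
  have h₃ : m • (w : ℍ → ℂ) = p ^ (i - j) • v₂ := by
    apply hcancel j
    rw [smul_smul, smul_smul, ← pow_add, Nat.add_sub_cancel' hji, ← h₂, hlt, add_smul, one_smul,
      add_sub_cancel_left]
  obtain ⟨y, hy⟩ : ∃ y : weakForms 1 t, w = p ^ (i - j) • y := by
    have hcop : Int.gcd m (p ^ (i - j) : ℕ) = 1 := by
      rw [Int.gcd_natCast_natCast]
      exact hm.pow_right _
    have hb := Int.gcd_eq_gcd_ab m (p ^ (i - j) : ℕ)
    rw [hcop] at hb
    -- Bézout for `m` and `p ^ (i - j)`: write `w = (a m + b p ^ (i - j)) w` and replace `m w` by `p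
    -- ^ (i - j) v₂`.
    refine ⟨Int.gcdA m (p ^ (i - j) : ℕ) • ⟨v₂, hv₂⟩ + Int.gcdB m (p ^ (i - j) : ℕ) • w, ?_⟩
    have h₄ : (m : ℤ) • w = ((p ^ (i - j) : ℕ) : ℤ) • (⟨v₂, hv₂⟩ : weakForms 1 t) := by
      rw [natCast_zsmul, natCast_zsmul]
      exact Subtype.ext h₃
    rw [← natCast_zsmul, smul_add, smul_comm _ (Int.gcdA _ _), ← h₄, smul_smul, smul_smul,
      ← add_smul, mul_comm _ (m : ℤ), ← hb]
    simp
  have hyA : Submodule.Quotient.mk ((1 : ℤ_[p]) ⊗ₜ[ℤ] y) ∈ A p l t j := by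
    refine mk_one_tmul_mem_A.mpr ⟨⟨v₁, hv₁, hcancel (i - j) ?_⟩, m • y, nsmul_mem y.2 m, ?_⟩
    · rw [smul_smul, ← hi, ← h₁, hy]
      ext τ
      simp
      ring
    · rw [hlt, add_smul, one_smul, add_sub_cancel_left, mul_smul]
  refine ⟨⟨_, hyA⟩, Subtype.ext ?_⟩
  rw [transition_mk, ← Nat.cast_pow, natCast_smul_one_tmul, ← hy]

lemma toAInf_transition {i : ℕ} (hij : i ≤ j) (x : A p l t i) :
    toAInf p l t j (transition p l t i j hij x) = toAInf p l t i x :=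
  Module.DirectLimit.of_f

lemma exists_toAInf (x : AInf p l t) : ∃ j y, toAInf p l t j y = x :=
  Module.DirectLimit.exists_of x

lemma pow_smul_eq_zero (x : A p l t j) : p ^ j • x = 0 := by
  obtain ⟨x, hx⟩ := x
  obtain ⟨y, rfl⟩ := Submodule.Quotient.mk_surjective _ x
  refine Subtype.ext ((Submodule.Quotient.mk_eq_zero _).mpr ⟨y, ?_⟩)
  rw [LinearMap.lsmul_apply, ← Nat.cast_pow, Nat.cast_smul_eq_nsmul]

lemma pow_smul_toAInf_ne_zero (hj : 1 ≤ j) (hD : D.Coprime p) (hE : IsConstMod (p ^ j) D t E')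
    (he : (D : ℤ_[p]) • e = 1 ⊗ₜ E') (he' : Submodule.Quotient.mk e ∈ A p l t j) :
    p ^ (j - 1) • toAInf p l t j ⟨Submodule.Quotient.mk e, he'⟩ ≠ 0 := by
  have hpp : p.Prime := Fact.out
  intro h
  rw [← map_nsmul] at h
  -- Vanishing in the colimit happens at some level `i ≥ j`. There it reads `p ^ (j - 1) p ^ (i - j)
  -- E' = p ^ i v`, so `E' = p v`, against the unit constant term.
  obtain ⟨i, hji, hi⟩ := Module.DirectLimit.of.zero_exact h
  rw [map_nsmul] at hi
  have h1 := congrArg Subtype.val hi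
  rw [Submodule.coe_smul_of_tower, transition_mk, ← Submodule.Quotient.mk_smul, Submodule.coe_zero,
    Submodule.Quotient.mk_eq_zero, ← mem_powSubmodule_smul_iff hD, smul_comm, smul_comm (D : ℤ_[p]),
    he, ← Nat.cast_pow, natCast_smul_one_tmul, ← TensorProduct.tmul_smul,
    one_tmul_mem_powSubmodule] at h1
  obtain ⟨v, hv⟩ := h1
  refine hE.ne_smul hpp (dvd_pow_self p (by omega)) hD v.2 ?_
  have h2 := congrArg Subtype.val hv
  have hpi : p ^ i = (p ^ (j - 1) * p ^ (i - j)) * p := by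
    rw [← pow_add, ← pow_succ]
    congr 1
    omega
  rw [smul_smul, hpi, mul_smul _ p] at h2
  exact smul_right_injective (ℍ → ℂ)
    (mul_ne_zero (pow_ne_zero _ hpp.ne_zero) (pow_ne_zero _ hpp.ne_zero)) h2

lemma zmultiples_toAInf_eq_top {m : ℕ} (hl : 2 ≤ l) (hD : D.Coprime p)
    (hE : IsConstMod (p ^ j) D t E') (he : (D : ℤ_[p]) • e = 1 ⊗ₜ E') (hm : m.Coprime p)
    (hlt : l ^ t = 1 + p ^ j * m) (he' : Submodule.Quotient.mk e ∈ A p l t j) :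
    AddSubgroup.zmultiples (toAInf p l t j ⟨Submodule.Quotient.mk e, he'⟩) = ⊤ := by
  refine (AddSubgroup.eq_top_iff' _).mpr fun x => ?_
  obtain ⟨i, y, rfl⟩ := exists_toAInf x
  -- An element from any level `i` is pushed up to level `max j i` and then lifted back to level
  -- `j`, where the generator is known.
  obtain ⟨z, hz⟩ := transition_surjective (p := p) (le_max_left j i) hm hlt
    (transition p l t i _ (le_max_right j i) y)
  have hlt' : l ^ t ≡ 1 [MOD p ^ j] := by
    rw [hlt]
    simp [Nat.ModEq]
  obtain ⟨c, rfl⟩ := eq_smul_of_mem_A hl hD hE he hlt' he' z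
  refine AddSubgroup.mem_zmultiples_iff.mpr ⟨c, ?_⟩
  have h := congrArg (toAInf p l t _) hz
  rw [toAInf_transition, toAInf_transition] at h
  exact (map_zsmul (toAInf p l t j) c _).symm.trans h

lemma addOrderOf_toAInf (hj : 1 ≤ j) (hD : D.Coprime p) (hE : IsConstMod (p ^ j) D t E')
    (he : (D : ℤ_[p]) • e = 1 ⊗ₜ E') (he' : Submodule.Quotient.mk e ∈ A p l t j) :
    addOrderOf (toAInf p l t j ⟨Submodule.Quotient.mk e, he'⟩) = p ^ j := by
  have h := pow_smul_toAInf_ne_zero hj hD hE he he'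
  obtain ⟨i, rfl⟩ : ∃ i, j = i + 1 := ⟨j - 1, by omega⟩
  refine addOrderOf_eq_prime_pow h ?_
  rw [← map_nsmul, pow_smul_eq_zero, map_zero]

/-- The class of `1` at level `j` plays the part of `1 / p ^ j`: the transition to level `j + 1`
multiplies by `p`, so `p` times the next class is the present one. -/
lemma nonempty_AInf_zero_equiv (hl : 2 ≤ l) : Nonempty (AInf p l 0 ≃+ ZModPInf p) := by
  let ω : weakForms 1 ((0 : ℕ) : ℤ) := ⟨1, (isConstMod_one 1).mem_weakForms⟩
  have hD : Nat.Coprime 1 p := Nat.coprime_one_left p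
  have hE : ∀ j, IsConstMod (p ^ j) 1 0 ω := fun j => isConstMod_one _
  have he : ((1 : ℕ) : ℤ_[p]) • ((1 : ℤ_[p]) ⊗ₜ[ℤ] ω) = 1 ⊗ₜ ω := by simp
  have hlt : ∀ j, l ^ 0 ≡ 1 [MOD p ^ j] := fun j => by rw [pow_zero]
  have hA : ∀ j, Submodule.Quotient.mk ((1 : ℤ_[p]) ⊗ₜ[ℤ] ω) ∈ A p l 0 j := fun j =>
    mk_mem_A_of_isConstMod hD (hE j) he (hlt j)
  refine nonempty_addEquiv_ZModPInf (fun j => toAInf p l 0 j ⟨_, hA j⟩) ?_ ?_ ?_ ?_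
  · have := pow_smul_eq_zero (p := p) (l := l) (j := 0) ⟨_, hA 0⟩
    rw [pow_zero, one_smul] at this
    simp only [this, map_zero]
  · simpa using pow_smul_toAInf_ne_zero le_rfl hD (hE 1) he (hA 1)
  · intro j
    rw [← map_smul, ← toAInf_transition (Nat.le_succ j)]
    congr 1
    refine Subtype.ext ?_
    rw [transition_mk]
    simp
  · intro x
    obtain ⟨j, y, rfl⟩ := exists_toAInf x
    obtain ⟨c, rfl⟩ := eq_smul_of_mem_A hl hD (hE j) he (hlt j) (hA j) y
    refine ⟨j, c, ?_⟩
    rw [map_zsmul, Int.cast_smul_eq_zsmul]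

/-- For two denominators `D` and `D'`, both elements become `1 ⊗ D D' f` after multiplication by the
unit `D D'`. -/
lemma IsImageOf.unique {k : ℕ} {e e' : Cochain0 p k} {f : ℍ → ℂ} (h : IsImageOf e f)
    (h' : IsImageOf e' f) : e = e' := by
  obtain ⟨D, hD, hf, he⟩ := h
  obtain ⟨D', hD', hf', he'⟩ := h'
  have hu := (isUnit_natCast_of_coprime hD).mul (isUnit_natCast_of_coprime hD')
  rw [← sub_eq_zero, ← hu.smul_eq_zero, smul_sub, sub_eq_zero, mul_smul, mul_smul, he',
    smul_comm, he, natCast_smul_one_tmul, natCast_smul_one_tmul]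
  congr 1
  refine Subtype.ext ?_
  exact smul_comm D' D f

lemma exists_isImageOf {k : ℕ} {f : ℍ → ℂ} (hD : D.Coprime p) (hf : D • f ∈ weakForms 1 k) :
    ∃ e : Cochain0 p k, (D : ℤ_[p]) • e = (1 : ℤ_[p]) ⊗ₜ[ℤ] (⟨D • f, hf⟩ : weakForms 1 k) := by
  obtain ⟨u, hu⟩ := isUnit_natCast_of_coprime hD
  refine ⟨(u⁻¹ : ℤ_[p]ˣ) • ((1 : ℤ_[p]) ⊗ₜ[ℤ] (⟨D • f, hf⟩ : weakForms 1 k)), ?_⟩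
  rw [← hu]
  exact smul_inv_smul u (_ : Cochain0 p k)

end Cohomology

end QlComplex

end

/-! ### Assembly for Eisenstein series and for weight `0` -/

theorem proposition9p6 (p ℓ : ℕ) [Fact p.Prime] [Fact ℓ.Prime] (hp : 5 ≤ p)
    (u : ℤ_[p]ˣ) (hu : (u : ℤ_[p]) = (ℓ : ℤ_[p]))
    (hgen : Dense ((Subgroup.zpowers u : Subgroup ℤ_[p]ˣ) : Set ℤ_[p]ˣ)) :
    (∀ (t j s : ℕ) (ht : 4 ≤ t), 1 ≤ j → s.Coprime p → t = (p - 1) * p ^ (j - 1) * s →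
      (∃! e : QlComplex.Cochain0 p t,
        QlComplex.IsImageOf e (ModularForm.E (show 3 ≤ t by omega))) ∧
      (∀ e : QlComplex.Cochain0 p t,
        QlComplex.IsImageOf e (ModularForm.E (show 3 ≤ t by omega)) →
        ∃ he : Submodule.Quotient.mk e ∈ QlComplex.A p ℓ t j,
          AddSubgroup.zmultiples (QlComplex.toAInf p ℓ t j ⟨Submodule.Quotient.mk e, he⟩) = ⊤ ∧
          addOrderOf (QlComplex.toAInf p ℓ t j ⟨Submodule.Quotient.mk e, he⟩) = p ^ j) ∧
      padicValNat p (bernoulli t / t).den = j) ∧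
    Nonempty (QlComplex.AInf p ℓ 0 ≃+ QlComplex.ZModPInf p) := by
  have hpp : p.Prime := Fact.out
  have hl : 2 ≤ ℓ := (Fact.out : ℓ.Prime).two_le
  refine ⟨fun t j s ht hj hs hts => ?_, QlComplex.nonempty_AInf_zero_equiv hl⟩
  have hv := QlComplex.padicValRat_bernoulli_div (p := p) (by omega) hj hs hts
  have ht2 : Even t := by
    rw [hts]
    exact ((hpp.even_sub_one (by omega)).mul_right _).mul_right _
  obtain ⟨D, hD, hE⟩ := QlComplex.exists_isConstMod_E hj (show 3 ≤ t by omega) ht2 hv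
  obtain ⟨e₀, he₀⟩ := QlComplex.exists_isImageOf hD hE.mem_weakForms
  have himg : QlComplex.IsImageOf e₀ (ModularForm.E (show 3 ≤ t by omega)) :=
    ⟨D, hD, hE.mem_weakForms, he₀⟩
  obtain ⟨m, hm, hlt⟩ := QlComplex.exists_pow_eq_one_add (by omega) hu hgen hj hs hts
  refine ⟨⟨e₀, himg, fun e he => he.unique himg⟩, fun e he => ?_,
    (QlComplex.padicValNat_den_eq hv).1⟩
  obtain rfl := he.unique himg
  have hlt' : ℓ ^ t ≡ 1 [MOD p ^ j] := by
    rw [hlt]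
    simp [Nat.ModEq]
  have hA := QlComplex.mk_mem_A_of_isConstMod hD hE he₀ hlt'
  exact ⟨hA, QlComplex.zmultiples_toAInf_eq_top hl hD hE he₀ hm hlt hA,
    QlComplex.addOrderOf_toAInf hj hD hE he₀ hA⟩
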